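/- Let $k$ be an algebraically closed field and let $A$ be a finite commutative group scheme over $k$, given by its coordinate algebra $\mathcal{O}(A)$, a finite dimensional commutative and cocommutative Hopf algebra. Let $A^D$ be its Cartier dual, so $\mathcal{O}(A^D)=k[A]:=\mathcal{O}(A)^*$, and let $\langle\,,\rangle:A^D\times A\to\mathbb{G}_m$ be the canonical pairing. Put $H:=A\times A^D$ and $k[H]:=\mathcal{O}(H)^*$. A *twist* for a Hopf algebra $K$ is an invertible $\psi\in K\otimes K$ with $(\Delta\otimes \mathrm{id})(\psi)(\psi\otimes 1)=(\mathrm{id}\otimes\Delta)(\psi)(1\otimes\psi)$ and $(\varepsilon\otimes \mathrm{id})(\psi)=(\mathrm{id}\otimes\varepsilon)(\psi)=1$; for $K=\mathcal{O}(H)$ this is the same as a normalized $2$-cocycle $H\times H\to\mathbb{G}_m$, and two of these are cohomologous if $\psi'=\Delta(x)\,\psi\,(x^{-1}\otimes x^{-1})$ for some invertible $x$. Let $K_\psi$ be the coalgebra $K$ with comultiplication $\Delta_\psi(a)=\Delta(a)\psi$ and the counit of $K$. For finite dimensional $K$, the twist $\psi$ is *nondegenerate* if the category $\mathrm{Corep}(K_\psi)$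 of finite dimensional $K_\psi$-comodules is equivalent to the category $\mathrm{Vec}$ of finite dimensional vector spaces (as a $k$-linear category), i.e. if the coalgebra $K_\psi$ is simple. A twist $\psi$ for $\mathcal{O}(H)$ *corresponds* to a twist $J$ for $k[H]$ if $\mathrm{Corep}(\mathcal{O}(H)_\psi)$ is equivalent, as a module category over $\mathrm{Rep}(H)$, to $\mathrm{Vec}$ with the module structure given by the forgetful functor $\mathrm{Rep}(H)\to\mathrm{Vec}$ with tensor structure $J$. **Proposition.** The function $\psi((a_1,f_1),(a_2,f_2))=\langle f_1,a_2\rangle$ is a normalized $2$-cocycle $H\times H\to\mathbb{G}_m$, and its class in $H^2(H,\mathbb{G}_m)$ is nondegenerate, that is, every normalized $2$-cocycle cohomologous to $\psi$ is nondegenerate. This class corresponds to a nondegenerate twist for $k[H]=k[A\times A^D]$: there is a nondegenerate twist $J$ for $k[H]$ to which every normalized $2$-cocycle cohomologous to $\psi$ corresponds. -/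

import Mathlib

open TensorProduct CategoryTheory

universe u v w

noncomputable section

/-- The linear dual `K* = Hom_k(K, k)`, with the convolution product
`(ξ * η)(a) = ξ(a₁) η(a₂)` and unit `ε`.  In finite dimension it is again a Hopf algebra. -/
def DualHopf (k : Type u) (K : Type v) [Field k] [Ring K] [HopfAlgebra k K] : Type (max u v) :=
  WithConv (K →ₗ[k] k)

namespace DualHopf

variable (k : Type u) (K : Type v) [Field k] [Ring K] [HopfAlgebra k K]

instance : Ring (DualHopf k K) := inferInstanceAs (Ring (WithConv (K →ₗ[k] k)))

instance : Algebra k (DualHopf k K) := inferInstanceAs (Algebra k (WithConv (K →ₗ[k] k)))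

/-- The underlying linear functional of an element of `K*`. -/
def toDual : DualHopf k K ≃ₗ[k] Module.Dual k K where
  toFun ξ := WithConv.ofConv ξ
  invFun ξ := WithConv.toConv ξ
  map_add' _ _ := rfl
  map_smul' _ _ := rfl

theorem toDual_mul (ξ η : DualHopf k K) :
    toDual k K (ξ * η) = LinearMap.mul' k k ∘ₗ
      TensorProduct.map (toDual k K ξ) (toDual k K η) ∘ₗ Coalgebra.comul := rfl

theorem toDual_mul_apply (ξ η : DualHopf k K) (a : K) :
    toDual k K (ξ * η) a = LinearMap.mul' k k
      (TensorProduct.map (toDual k K ξ) (toDual k K η) (Coalgebra.comul a)) := rfl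

@[simp]
theorem toDual_one (a : K) : toDual k K 1 a = Coalgebra.counit a := rfl

/-- The evaluation pairing `(ξ ⊗ η)(a ⊗ b) = ξ(a) η(b)`. -/
def pair : DualHopf k K ⊗[k] DualHopf k K →ₗ[k] Module.Dual k (K ⊗[k] K) :=
  TensorProduct.dualDistrib k K K ∘ₗ
    TensorProduct.map (toDual k K).toLinearMap (toDual k K).toLinearMap

@[simp]
theorem pair_tmul (ξ η : DualHopf k K) (a b : K) :
    pair k K (ξ ⊗ₜ η) (a ⊗ₜ b) = toDual k K ξ a * toDual k K η b := by
  simp [pair]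

/-- The evaluation pairing `(ξ ⊗ η ⊗ ζ)(a ⊗ b ⊗ c) = ξ(a) η(b) ζ(c)`. -/
def pair₃ : DualHopf k K ⊗[k] (DualHopf k K ⊗[k] DualHopf k K) →ₗ[k]
    Module.Dual k (K ⊗[k] (K ⊗[k] K)) :=
  TensorProduct.dualDistrib k K (K ⊗[k] K) ∘ₗ
    TensorProduct.map (toDual k K).toLinearMap (pair k K)

theorem pair₃_tmul (ξ : DualHopf k K) (y : DualHopf k K ⊗[k] DualHopf k K) (a : K)
    (z : K ⊗[k] K) : pair₃ k K (ξ ⊗ₜ y) (a ⊗ₜ z) = toDual k K ξ a * pair k K y z := by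
  simp [pair₃]

theorem pair_mul (x y : DualHopf k K ⊗[k] DualHopf k K) :
    pair k K (x * y) = LinearMap.mul' k k ∘ₗ
      TensorProduct.map (pair k K x) (pair k K y) ∘ₗ Coalgebra.comul := by
  induction x with
  | zero => simp
  | add x₁ x₂ h₁ h₂ =>
    simp only [add_mul, map_add, h₁, h₂, TensorProduct.map_add_left, LinearMap.add_comp,
      LinearMap.comp_add]
  | tmul ξ₁ ξ₂ =>
    induction y with
    | zero => simp
    | add x₁ x₂ h₁ h₂ =>
      simp only [mul_add, map_add, h₁, h₂, TensorProduct.map_add_right, LinearMap.add_comp,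
        LinearMap.comp_add]
    | tmul η₁ η₂ =>
      ext a b
      simp only [Algebra.TensorProduct.tmul_mul_tmul, TensorProduct.AlgebraTensorModule.curry_apply,
        TensorProduct.curry_apply, LinearMap.coe_restrictScalars, pair_tmul,
        toDual_mul_apply, LinearMap.comp_apply, TensorProduct.comul_tmul]
      hopf_tensor_induction Coalgebra.comul (R := k) a with a₁ a₂
      hopf_tensor_induction Coalgebra.comul (R := k) b with b₁ b₂
      simp
      ring

theorem pair₃_assoc_tmul (y : DualHopf k K ⊗[k] DualHopf k K) (η : DualHopf k K) (a b c : K) :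
    pair₃ k K (TensorProduct.assoc k _ _ _ (y ⊗ₜ η)) (a ⊗ₜ (b ⊗ₜ c)) =
      pair k K y (a ⊗ₜ b) * toDual k K η c := by
  induction y with
  | zero => simp
  | add x y hx hy => simp only [add_tmul, map_add, LinearMap.add_apply, add_mul, hx, hy]
  | tmul x y => simp [pair₃_tmul, mul_assoc]

variable [FiniteDimensional k K]

instance : FiniteDimensional k (DualHopf k K) :=
  Module.Finite.equiv (toDual k K).symm

/-- The evaluation pairing is perfect in finite dimension. -/
def pairEquiv : DualHopf k K ⊗[k] DualHopf k K ≃ₗ[k] Module.Dual k (K ⊗[k] K) :=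
  TensorProduct.congr (toDual k K) (toDual k K) ≪≫ₗ
    TensorProduct.dualDistribEquiv k K K

theorem pairEquiv_apply (x : DualHopf k K ⊗[k] DualHopf k K) : pairEquiv k K x = pair k K x := rfl

theorem pair_injective : Function.Injective (pair k K) := (pairEquiv k K).injective

theorem pair₃_injective : Function.Injective (pair₃ k K) :=
  (TensorProduct.congr (toDual k K) (pairEquiv k K) ≪≫ₗ
    TensorProduct.dualDistribEquiv k K (K ⊗[k] K)).injective

/-- The coalgebra structure dual to the algebra `K`: `Δ(ξ)(a ⊗ b) = ξ(a b)` and `ε(ξ) = ξ(1)`. -/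
instance : CoalgebraStruct k (DualHopf k K) where
  comul := (pairEquiv k K).symm.toLinearMap ∘ₗ (LinearMap.mul' k K).dualMap ∘ₗ
    (toDual k K).toLinearMap
  counit := LinearMap.applyₗ (1 : K) ∘ₗ (toDual k K).toLinearMap

theorem pair_comul' (ξ : DualHopf k K) :
    pair k K (CoalgebraStruct.comul ξ) = toDual k K ξ ∘ₗ LinearMap.mul' k K := by
  rw [← pairEquiv_apply]
  exact (pairEquiv k K).apply_symm_apply _

@[simp]
theorem pair_comul (ξ : DualHopf k K) (a b : K) :
    pair k K (CoalgebraStruct.comul ξ) (a ⊗ₜ b) = toDual k K ξ (a * b) := by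
  rw [pair_comul']; simp

@[simp]
theorem counit_apply (ξ : DualHopf k K) : CoalgebraStruct.counit (R := k) ξ = toDual k K ξ 1 := rfl

instance : Coalgebra k (DualHopf k K) where
  coassoc := by
    ext ξ : 1
    apply pair₃_injective
    apply TensorProduct.ext_threefold'
    intro a b c
    simp only [LinearMap.comp_apply, LinearEquiv.coe_coe]
    have h1 : ∀ y : DualHopf k K ⊗[k] DualHopf k K,
        pair₃ k K (TensorProduct.assoc k _ _ _
          ((CoalgebraStruct.comul (R := k) (A := DualHopf k K)).rTensor _ y)) (a ⊗ₜ (b ⊗ₜ c)) =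
        pair k K y ((a * b) ⊗ₜ c) := by
      intro y
      induction y with
      | zero => simp
      | add x y hx hy => simp only [map_add, LinearMap.add_apply, hx, hy]
      | tmul x y => simp [pair₃_assoc_tmul]
    have h2 : ∀ y : DualHopf k K ⊗[k] DualHopf k K,
        pair₃ k K ((CoalgebraStruct.comul (R := k) (A := DualHopf k K)).lTensor _ y)
          (a ⊗ₜ (b ⊗ₜ c)) = pair k K y (a ⊗ₜ (b * c)) := by
      intro y
      induction y with
      | zero => simp
      | add x y hx hy => simp only [map_add, LinearMap.add_apply, hx, hy]
      | tmul x y => simp [pair₃_tmul]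
    rw [h1, h2]
    simp [mul_assoc]
  rTensor_counit_comp_comul := by
    ext ξ : 1
    apply (TensorProduct.lid k _).injective
    have h : ∀ (y : DualHopf k K ⊗[k] DualHopf k K) (a : K),
        toDual k K (TensorProduct.lid k _ ((CoalgebraStruct.counit (R := k) (A := DualHopf k K)).rTensor _ y)) a
          = pair k K y (1 ⊗ₜ a) := by
      intro y a
      induction y with
      | zero => simp
      | add x y hx hy => simp only [map_add, LinearMap.add_apply, hx, hy]
      | tmul x y => simp
    apply (toDual k K).injective
    ext a
    simp [h]
  lTensor_counit_comp_comul := by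
    ext ξ : 1
    apply (TensorProduct.rid k _).injective
    have h : ∀ (y : DualHopf k K ⊗[k] DualHopf k K) (a : K),
        toDual k K (TensorProduct.rid k _ ((CoalgebraStruct.counit (R := k) (A := DualHopf k K)).lTensor _ y)) a
          = pair k K y (a ⊗ₜ 1) := by
      intro y a
      induction y with
      | zero => simp
      | add x y hx hy => simp only [map_add, LinearMap.add_apply, hx, hy]
      | tmul x y => simp [mul_comm]
    apply (toDual k K).injective
    ext a
    simp [h]

theorem toDual_mul_mul (ξ η : DualHopf k K) (a b : K) :
    toDual k K (ξ * η) (a * b) =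
      pair k K (Coalgebra.comul ξ * Coalgebra.comul η) (a ⊗ₜ b) := by
  rw [pair_mul, pair_comul', pair_comul', toDual_mul_apply, Bialgebra.comul_mul]
  simp only [LinearMap.comp_apply, TensorProduct.comul_tmul]
  hopf_tensor_induction Coalgebra.comul (R := k) a with a₁ a₂
  hopf_tensor_induction Coalgebra.comul (R := k) b with b₁ b₂
  simp

instance : Bialgebra k (DualHopf k K) :=
  Bialgebra.mk' k (DualHopf k K)
    (by simp)
    (by intro ξ η; simp [toDual_mul_apply, Algebra.TensorProduct.one_def])
    (by
      apply pair_injective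
      apply TensorProduct.ext'
      intro a b
      rw [pair_comul, Algebra.TensorProduct.one_def, pair_tmul]
      simp)
    (by
      intro ξ η
      apply pair_injective
      apply TensorProduct.ext'
      intro a b
      rw [pair_comul, toDual_mul_mul])

/-- The dual Hopf algebra: the antipode is the transpose of the antipode of `K`. -/
instance : HopfAlgebra k (DualHopf k K) where
  antipode := (toDual k K).symm.toLinearMap ∘ₗ
    (HopfAlgebra.antipode k (A := K)).dualMap ∘ₗ (toDual k K).toLinearMap
  mul_antipode_rTensor_comul := by
    ext ξ : 1
    have h : ∀ (y : DualHopf k K ⊗[k] DualHopf k K) (a : K),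
        toDual k K (LinearMap.mul' k _ (((toDual k K).symm.toLinearMap ∘ₗ
          (HopfAlgebra.antipode k (A := K)).dualMap ∘ₗ (toDual k K).toLinearMap).rTensor _ y)) a =
        pair k K y ((HopfAlgebra.antipode k (A := K)).rTensor _ (Coalgebra.comul a)) := by
      intro y a
      induction y with
      | zero => simp
      | add x y hx hy => simp only [map_add, LinearMap.add_apply, hx, hy]
      | tmul x y =>
        simp only [LinearMap.rTensor_tmul, LinearMap.mul'_apply, toDual_mul_apply]
        hopf_tensor_induction Coalgebra.comul (R := k) a with a₁ a₂
        simp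
    apply (toDual k K).injective
    ext a
    simp only [LinearMap.comp_apply]
    rw [h, pair_comul', LinearMap.comp_apply, HopfAlgebra.mul_antipode_rTensor_comul_apply]
    simp [Algebra.algebraMap_eq_smul_one, mul_comm]
  mul_antipode_lTensor_comul := by
    ext ξ : 1
    have h : ∀ (y : DualHopf k K ⊗[k] DualHopf k K) (a : K),
        toDual k K (LinearMap.mul' k _ (((toDual k K).symm.toLinearMap ∘ₗ
          (HopfAlgebra.antipode k (A := K)).dualMap ∘ₗ (toDual k K).toLinearMap).lTensor _ y)) a =
        pair k K y ((HopfAlgebra.antipode k (A := K)).lTensor _ (Coalgebra.comul a)) := by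
      intro y a
      induction y with
      | zero => simp
      | add x y hx hy => simp only [map_add, LinearMap.add_apply, hx, hy]
      | tmul x y =>
        simp only [LinearMap.lTensor_tmul, LinearMap.mul'_apply, toDual_mul_apply]
        hopf_tensor_induction Coalgebra.comul (R := k) a with a₁ a₂
        simp
    apply (toDual k K).injective
    ext a
    simp only [LinearMap.comp_apply]
    rw [h, pair_comul', LinearMap.comp_apply, HopfAlgebra.mul_antipode_lTensor_comul_apply]
    simp [Algebra.algebraMap_eq_smul_one, mul_comm]

end DualHopf

/-! ### Twists and twisted coalgebras -/

section Twist

variable (k : Type u) (K : Type v) [Field k] [Ring K] [HopfAlgebra k K]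

/-- A (Drinfeld) twist for a Hopf algebra `K`: an invertible `ψ ∈ K ⊗ K` such that
`(Δ ⊗ id)(ψ) (ψ ⊗ 1) = (id ⊗ Δ)(ψ) (1 ⊗ ψ)` and `(ε ⊗ id)(ψ) = 1 = (id ⊗ ε)(ψ)`.
For `K = 𝒪(H)` these are the normalized 2-cocycles `H × H → 𝔾ₘ`. -/
structure IsTwist (ψ : K ⊗[k] K) : Prop where
  isUnit : IsUnit ψ
  cocycle :
    Algebra.TensorProduct.assoc k k k K K K
        (Algebra.TensorProduct.map (Bialgebra.comulAlgHom k K) (AlgHom.id k K) ψ * (ψ ⊗ₜ[k] 1)) =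
      Algebra.TensorProduct.map (AlgHom.id k K) (Bialgebra.comulAlgHom k K) ψ * (1 ⊗ₜ[k] ψ)
  counit_left : Algebra.TensorProduct.lid k K
    (Algebra.TensorProduct.map (Bialgebra.counitAlgHom k K) (AlgHom.id k K) ψ) = 1
  counit_right : Algebra.TensorProduct.rid k k K
    (Algebra.TensorProduct.map (AlgHom.id k K) (Bialgebra.counitAlgHom k K) ψ) = 1

/-- Two twists are cohomologous (gauge equivalent) if `ψ' = Δ(x) ψ (x⁻¹ ⊗ x⁻¹)` for some
invertible `x ∈ K`; for `K = 𝒪(H)` this says that the 2-cocycles define the same class in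
`H²(H, 𝔾ₘ)`. -/
def Cohomologous (ψ ψ' : K ⊗[k] K) : Prop :=
  ∃ x : Kˣ, ψ' = Coalgebra.comul (R := k) (x : K) * ψ * ((↑x⁻¹ : K) ⊗ₜ[k] (↑x⁻¹ : K))

variable {k K}

namespace Twist

variable {ψ : K ⊗[k] K}

/-- The twisted comultiplication `Δ_ψ(a) = Δ(a) ψ`. -/
def twistedComul (ψ : K ⊗[k] K) : K →ₗ[k] K ⊗[k] K :=
  LinearMap.mulRight k ψ ∘ₗ Coalgebra.comul

theorem twistedComul_apply (ψ : K ⊗[k] K) (a : K) :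
    twistedComul ψ a = Coalgebra.comul a * ψ := rfl

theorem twistedComul_coassoc (hψ : IsTwist k K ψ) :
    TensorProduct.assoc k K K K ∘ₗ (twistedComul ψ).rTensor K ∘ₗ twistedComul ψ =
      (twistedComul ψ).lTensor K ∘ₗ twistedComul ψ := by
  have hr : ∀ z : K ⊗[k] K, (twistedComul ψ).rTensor K z =
      Algebra.TensorProduct.map (Bialgebra.comulAlgHom k K) (AlgHom.id k K) z * (ψ ⊗ₜ[k] 1) := by
    intro z
    induction z with
    | zero => simp
    | add x y hx hy => simp only [map_add, hx, hy, add_mul]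
    | tmul x y => simp [twistedComul_apply]
  have hl : ∀ z : K ⊗[k] K, (twistedComul ψ).lTensor K z =
      Algebra.TensorProduct.map (AlgHom.id k K) (Bialgebra.comulAlgHom k K) z * (1 ⊗ₜ[k] ψ) := by
    intro z
    induction z with
    | zero => simp
    | add x y hx hy => simp only [map_add, hx, hy, add_mul]
    | tmul x y => simp [twistedComul_apply]
  have hc : ∀ a : K, Algebra.TensorProduct.assoc k k k K K K
      (Algebra.TensorProduct.map (Bialgebra.comulAlgHom k K) (AlgHom.id k K)
        (Coalgebra.comul a)) =
      Algebra.TensorProduct.map (AlgHom.id k K) (Bialgebra.comulAlgHom k K)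
        (Coalgebra.comul a) := fun a => Coalgebra.coassoc_apply a
  ext a
  change TensorProduct.assoc k K K K ((twistedComul ψ).rTensor K (twistedComul ψ a)) =
    (twistedComul ψ).lTensor K (twistedComul ψ a)
  change Algebra.TensorProduct.assoc k k k K K K _ = _
  rw [hr, hl, twistedComul_apply,
    map_mul (Algebra.TensorProduct.map (Bialgebra.comulAlgHom k K) (AlgHom.id k K)), mul_assoc,
    map_mul, hc, hψ.cocycle, map_mul, mul_assoc]

/-- The counit of `K`, which is also the counit of `K_ψ`. -/
def twistedCounit (k : Type u) (K : Type v) [Field k] [Ring K] [HopfAlgebra k K] : K →ₗ[k] k :=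
  Coalgebra.counit

theorem twistedComul_counit_left (hψ : IsTwist k K ψ) :
    (Coalgebra.counit : K →ₗ[k] k).rTensor K ∘ₗ twistedComul ψ = TensorProduct.mk k k K 1 := by
  ext a
  have h : ∀ z : K ⊗[k] K, (Coalgebra.counit : K →ₗ[k] k).rTensor K z =
      Algebra.TensorProduct.map (Bialgebra.counitAlgHom k K) (AlgHom.id k K) z := fun _ => rfl
  have h1 : Algebra.TensorProduct.map (Bialgebra.counitAlgHom k K) (AlgHom.id k K) ψ = 1 := by
    apply (Algebra.TensorProduct.lid k K).injective
    rw [hψ.counit_left, map_one]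
  rw [LinearMap.comp_apply, h, twistedComul_apply, map_mul, h1, mul_one, ← h,
    Coalgebra.rTensor_counit_comul, TensorProduct.mk_apply]

theorem twistedComul_counit_right (hψ : IsTwist k K ψ) :
    (Coalgebra.counit : K →ₗ[k] k).lTensor K ∘ₗ twistedComul ψ =
      (TensorProduct.mk k K k).flip 1 := by
  ext a
  have h : ∀ z : K ⊗[k] K, (Coalgebra.counit : K →ₗ[k] k).lTensor K z =
      Algebra.TensorProduct.map (AlgHom.id k K) (Bialgebra.counitAlgHom k K) z := fun _ => rfl
  have h1 : Algebra.TensorProduct.map (AlgHom.id k K) (Bialgebra.counitAlgHom k K) ψ = 1 := by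
    apply (Algebra.TensorProduct.rid k k K).injective
    rw [hψ.counit_right, map_one]
  rw [LinearMap.comp_apply, h, twistedComul_apply, map_mul, h1, mul_one, ← h,
    Coalgebra.lTensor_counit_comul, LinearMap.flip_apply, TensorProduct.mk_apply]

/-- The twisted coalgebra `K_ψ`: the vector space `K` with comultiplication `Δ_ψ(a) = Δ(a) ψ`
and the counit of `K`. -/
@[reducible]
def twistedCoalgebra (hψ : IsTwist k K ψ) : Coalgebra k K where
  comul := twistedComul ψ
  counit := twistedCounit k K
  coassoc := twistedComul_coassoc hψ
  rTensor_counit_comp_comul := twistedComul_counit_left hψ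
  lTensor_counit_comp_comul := twistedComul_counit_right hψ

theorem map_mul_comul :
    TensorProduct.map (LinearMap.mul' k K) (LinearMap.mul' k K) ∘ₗ
      (TensorProduct.tensorTensorTensorComm k K K K K).toLinearMap ∘ₗ
        TensorProduct.map Coalgebra.comul (twistedComul ψ) =
      twistedComul ψ ∘ₗ LinearMap.mul' k K := by
  apply TensorProduct.ext'
  intro a b
  simp only [LinearMap.comp_apply, TensorProduct.map_tmul, twistedComul_apply,
    LinearMap.mul'_apply, LinearEquiv.coe_coe]
  rw [Bialgebra.comul_mul, mul_assoc]
  generalize Coalgebra.comul (R := k) a = x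
  generalize Coalgebra.comul (R := k) b * ψ = y
  induction x with
  | zero => simp
  | add x₁ x₂ h₁ h₂ => simp only [add_tmul, map_add, add_mul, h₁, h₂]
  | tmul x₁ x₂ =>
    induction y with
    | zero => simp
    | add y₁ y₂ h₁ h₂ => simp only [tmul_add, map_add, mul_add, h₁, h₂]
    | tmul y₁ y₂ => simp

theorem counit_mul_eq :
    twistedCounit k K ∘ₗ LinearMap.mul' k K =
      LinearMap.mul' k k ∘ₗ TensorProduct.map Coalgebra.counit (twistedCounit k K) := by
  apply TensorProduct.ext'
  intro a b
  exact Bialgebra.counit_mul (R := k) a b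

end Twist

end Twist

/-! ### Finite dimensional comodules -/

/-- A finite dimensional right comodule over a coalgebra `C`. -/
structure FDComod (k : Type u) (C : Type v) [Field k] [AddCommGroup C] [Module k C]
    (cs : Coalgebra k C) where
  /-- the underlying vector space -/
  carrier : Type u
  [addCommGroup : AddCommGroup carrier]
  [module : Module k carrier]
  [finite : FiniteDimensional k carrier]
  /-- the coaction `ρ : V → V ⊗ C` -/
  coact : carrier →ₗ[k] carrier ⊗[k] C
  coassoc : TensorProduct.assoc k carrier C C ∘ₗ coact.rTensor C ∘ₗ coact =
    cs.comul.lTensor carrier ∘ₗ coact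
  counit : cs.counit.lTensor carrier ∘ₗ coact =
    (TensorProduct.mk k carrier k).flip 1

namespace FDComod

attribute [instance] FDComod.addCommGroup FDComod.module FDComod.finite

section Category

variable {k : Type u} {C : Type v} [Field k] [AddCommGroup C] [Module k C] {cs : Coalgebra k C}

instance : CoeSort (FDComod k C cs) (Type u) := ⟨FDComod.carrier⟩

theorem coassoc_apply (V : FDComod k C cs) (v : V) :
    TensorProduct.assoc k V C C (V.coact.rTensor C (V.coact v)) =
      cs.comul.lTensor V (V.coact v) :=
  LinearMap.congr_fun V.coassoc v

theorem counit_apply (V : FDComod k C cs) (v : V) :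
    cs.counit.lTensor V (V.coact v) = v ⊗ₜ 1 :=
  LinearMap.congr_fun V.counit v

/-- A morphism of comodules is a linear map commuting with the coactions. -/
@[ext]
structure Hom (V W : FDComod k C cs) where
  /-- the underlying linear map -/
  lin : V.carrier →ₗ[k] W.carrier
  comm : W.coact ∘ₗ lin = lin.rTensor C ∘ₗ V.coact

instance : Category (FDComod k C cs) where
  Hom := Hom
  id V := ⟨LinearMap.id, by simp⟩
  comp f g := ⟨g.lin ∘ₗ f.lin, by
    rw [← LinearMap.comp_assoc, g.comm, LinearMap.comp_assoc, f.comm, LinearMap.rTensor_comp,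
      LinearMap.comp_assoc]⟩

@[simp] theorem id_lin (V : FDComod k C cs) : (𝟙 V : V ⟶ V).lin = LinearMap.id := rfl

@[simp] theorem comp_lin {U V W : FDComod k C cs} (f : U ⟶ V) (g : V ⟶ W) :
    (f ≫ g).lin = g.lin ∘ₗ f.lin := rfl

@[ext]
theorem hom_ext {V W : FDComod k C cs} {f g : V ⟶ W} (h : f.lin = g.lin) : f = g := Hom.ext h

/-- The subspace of comodule morphisms inside all linear maps. -/
def homSubmodule (V W : FDComod k C cs) : Submodule k (V →ₗ[k] W) where
  carrier := {f | W.coact ∘ₗ f = f.rTensor C ∘ₗ V.coact}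
  add_mem' {f g} hf hg := by
    simp only [Set.mem_ofPred_eq] at *
    rw [LinearMap.comp_add, hf, hg, LinearMap.rTensor_add, LinearMap.add_comp]
  zero_mem' := by simp
  smul_mem' c f hf := by
    simp only [Set.mem_ofPred_eq] at *
    rw [LinearMap.comp_smul, hf, LinearMap.rTensor_smul, LinearMap.smul_comp]

/-- Morphisms of comodules as elements of `homSubmodule`. -/
def homEquiv (V W : FDComod k C cs) : (V ⟶ W) ≃ homSubmodule V W where
  toFun f := ⟨f.lin, f.comm⟩
  invFun f := ⟨f.1, f.2⟩

instance (V W : FDComod k C cs) : AddCommGroup (V ⟶ W) := (homEquiv V W).addCommGroup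

instance (V W : FDComod k C cs) : Module k (V ⟶ W) := (homEquiv V W).module k

theorem add_lin {V W : FDComod k C cs} (f g : V ⟶ W) : (f + g).lin = f.lin + g.lin := rfl

theorem smul_lin {V W : FDComod k C cs} (c : k) (f : V ⟶ W) : (c • f).lin = c • f.lin := rfl

instance : Preadditive (FDComod k C cs) where
  add_comp _ _ _ f g h := by ext1; simp [add_lin, LinearMap.comp_add]
  comp_add _ _ _ f g h := by ext1; simp [add_lin, LinearMap.add_comp]

instance : Linear k (FDComod k C cs) where
  smul_comp _ _ _ c f g := by ext1; simp [smul_lin, LinearMap.comp_smul]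
  comp_smul _ _ _ f c g := by ext1; simp [smul_lin, LinearMap.smul_comp]

end Category

section Constructions

variable {k : Type u} [Field k]
variable {C : Type v} [AddCommGroup C] [Module k C] {cs : Coalgebra k C}
variable {D : Type w} [AddCommGroup D] [Module k D] {ds : Coalgebra k D}

/-- The coaction of `W ⊗ V`, for a vector space `W` and a comodule `V`. -/
def freeCoact (W : Type u) [AddCommGroup W] [Module k W] (V : FDComod k C cs) :
    W ⊗[k] V →ₗ[k] (W ⊗[k] V) ⊗[k] C :=
  (TensorProduct.assoc k W V C).symm ∘ₗ V.coact.lTensor W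

/-- The comodule `W ⊗ V`, for a vector space `W` (with trivial coaction) and a comodule `V`. -/
abbrev free (W : Type u) [AddCommGroup W] [Module k W] [FiniteDimensional k W] (V : FDComod k C cs) :
    FDComod k C cs where
  carrier := W ⊗[k] V
  coact := freeCoact W V
  coassoc := by
    apply TensorProduct.ext'
    intro x v
    have hl : ∀ z : V ⊗[k] C, TensorProduct.assoc k (W ⊗[k] V) C C
        ((freeCoact W V).rTensor C ((TensorProduct.assoc k W V C).symm (x ⊗ₜ z))) =
        (TensorProduct.assoc k W V (C ⊗[k] C)).symm
          (x ⊗ₜ (TensorProduct.assoc k V C C (V.coact.rTensor C z))) := by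
      intro z
      induction z with
      | zero => simp
      | add z₁ z₂ h₁ h₂ => simp only [tmul_add, map_add, h₁, h₂]
      | tmul y c =>
        simp only [freeCoact, TensorProduct.assoc_symm_tmul, LinearMap.rTensor_tmul,
          LinearMap.comp_apply, LinearMap.lTensor_tmul, LinearEquiv.coe_coe]
        generalize V.coact y = q
        induction q with
        | zero => simp
        | add q₁ q₂ h₁ h₂ => simp only [tmul_add, add_tmul, map_add, h₁, h₂]
        | tmul q₁ q₂ => simp
    have hr : ∀ z : V ⊗[k] C, cs.comul.lTensor (W ⊗[k] V)
        ((TensorProduct.assoc k W V C).symm (x ⊗ₜ z)) =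
        (TensorProduct.assoc k W V (C ⊗[k] C)).symm
          (x ⊗ₜ (cs.comul.lTensor V z)) := by
      intro z
      induction z with
      | zero => simp
      | add z₁ z₂ h₁ h₂ => simp only [tmul_add, map_add, h₁, h₂]
      | tmul y c => simp
    simp only [LinearMap.comp_apply, LinearEquiv.coe_coe]
    have e : freeCoact W V (x ⊗ₜ v) =
      (TensorProduct.assoc k W V C).symm (x ⊗ₜ V.coact v) := by simp [freeCoact]
    rw [e, hl, hr, coassoc_apply]
  counit := by
    apply TensorProduct.ext'
    intro x v
    have hr : ∀ z : V ⊗[k] C, cs.counit.lTensor (W ⊗[k] V)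
        ((TensorProduct.assoc k W V C).symm (x ⊗ₜ z)) =
        (TensorProduct.assoc k W V k).symm
          (x ⊗ₜ (cs.counit.lTensor V z)) := by
      intro z
      induction z with
      | zero => simp
      | add z₁ z₂ h₁ h₂ => simp only [tmul_add, map_add, h₁, h₂]
      | tmul y c => simp
    have e : freeCoact W V (x ⊗ₜ v) =
      (TensorProduct.assoc k W V C).symm (x ⊗ₜ V.coact v) := by simp [freeCoact]
    rw [LinearMap.comp_apply, e, hr, counit_apply]
    simp

/-- The morphism `f ⊗ id : W ⊗ V → W' ⊗ V`. -/
def freeMap {W W' : Type u} [AddCommGroup W] [Module k W] [FiniteDimensional k W]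
    [AddCommGroup W'] [Module k W'] [FiniteDimensional k W'] (f : W →ₗ[k] W') (V : FDComod k C cs) :
    free W V ⟶ free W' V where
  lin := f.rTensor V
  comm := by
    change freeCoact W' V ∘ₗ f.rTensor V = (f.rTensor V).rTensor C ∘ₗ freeCoact W V
    apply TensorProduct.ext'
    intro x v
    simp only [freeCoact, LinearMap.comp_apply, LinearMap.rTensor_tmul,
      LinearMap.lTensor_tmul, LinearEquiv.coe_coe]
    generalize V.coact v = z
    induction z with
    | zero => simp
    | add z₁ z₂ h₁ h₂ => simp only [tmul_add, map_add, h₁, h₂]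
    | tmul y c => simp

/-- The functor `W ↦ W ⊗ V` from finite dimensional vector spaces to comodules. -/
def freeFunctor (V : FDComod k C cs) : FGModuleCat.{u} k ⥤ FDComod k C cs where
  obj W := free W V
  map f := freeMap f.hom.hom V
  map_id W := by
    ext1
    exact LinearMap.rTensor_id _ _
  map_comp f g := by
    ext1
    exact LinearMap.rTensor_comp _ _ _

/-- The coaction `x ⊗ v ↦ x₀ ⊗ v₀ ⊗ m(x₁ ⊗ v₁)`. -/
def tensorCoact (m : D ⊗[k] C →ₗ[k] C) (X : FDComod k D ds) (V : FDComod k C cs) :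
    X ⊗[k] V →ₗ[k] (X ⊗[k] V) ⊗[k] C :=
  m.lTensor (X ⊗[k] V) ∘ₗ (TensorProduct.tensorTensorTensorComm k X D V C).toLinearMap ∘ₗ
    TensorProduct.map X.coact V.coact

/-- The tensor product of a `D`-comodule `X` and a `C`-comodule `V`, for a coalgebra morphism
`m : D ⊗ C → C`; its coaction is `x ⊗ v ↦ x₀ ⊗ v₀ ⊗ m(x₁ ⊗ v₁)`. -/
abbrev tensor (m : D ⊗[k] C →ₗ[k] C)
    (hm : TensorProduct.map m m ∘ₗ (TensorProduct.tensorTensorTensorComm k D D C C).toLinearMap ∘ₗ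
      TensorProduct.map ds.comul cs.comul = cs.comul ∘ₗ m)
    (hm' : cs.counit ∘ₗ m = LinearMap.mul' k k ∘ₗ TensorProduct.map ds.counit cs.counit)
    (X : FDComod k D ds) (V : FDComod k C cs) : FDComod k C cs where
  carrier := X ⊗[k] V
  coact := tensorCoact m X V
  coassoc := by
    apply TensorProduct.ext'
    intro x v
    let F : (X ⊗[k] (D ⊗[k] D)) ⊗[k] (V ⊗[k] (C ⊗[k] C)) →ₗ[k] (X ⊗[k] V) ⊗[k] (C ⊗[k] C) :=
      (TensorProduct.map m m ∘ₗ
        (TensorProduct.tensorTensorTensorComm k D D C C).toLinearMap).lTensor (X ⊗[k] V) ∘ₗ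
        (TensorProduct.tensorTensorTensorComm k X (D ⊗[k] D) V (C ⊗[k] C)).toLinearMap
    have hl : ∀ (p : X ⊗[k] D) (q : V ⊗[k] C), TensorProduct.assoc k (X ⊗[k] V) C C
        ((tensorCoact m X V).rTensor C (m.lTensor (X ⊗[k] V)
          (TensorProduct.tensorTensorTensorComm k X D V C (p ⊗ₜ q)))) =
        F ((TensorProduct.assoc k X D D (X.coact.rTensor D p)) ⊗ₜ
          (TensorProduct.assoc k V C C (V.coact.rTensor C q))) := by
      intro p q
      induction p with
      | zero => simp
      | add p₁ p₂ h₁ h₂ => simp only [add_tmul, map_add, h₁, h₂]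
      | tmul y d =>
        induction q with
        | zero => simp
        | add q₁ q₂ h₁ h₂ => simp only [tmul_add, map_add, h₁, h₂]
        | tmul w c =>
          simp only [tensorCoact, TensorProduct.tensorTensorTensorComm_tmul,
            LinearMap.lTensor_tmul, LinearMap.rTensor_tmul, LinearMap.comp_apply,
            TensorProduct.map_tmul, LinearEquiv.coe_coe]
          generalize X.coact y = a
          generalize V.coact w = b
          induction a with
          | zero => simp
          | add a₁ a₂ h₁ h₂ => simp only [add_tmul, map_add, h₁, h₂]
          | tmul a₁ a₂ =>
            induction b with
            | zero => simp
            | add b₁ b₂ h₁ h₂ => simp only [add_tmul, tmul_add, map_add, h₁, h₂]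
            | tmul b₁ b₂ => simp [F]
    have hr : ∀ (p : X ⊗[k] D) (q : V ⊗[k] C),
        cs.comul.lTensor (X ⊗[k] V) (m.lTensor (X ⊗[k] V)
          (TensorProduct.tensorTensorTensorComm k X D V C (p ⊗ₜ q))) =
        F ((ds.comul.lTensor X p) ⊗ₜ
          (cs.comul.lTensor V q)) := by
      intro p q
      induction p with
      | zero => simp
      | add p₁ p₂ h₁ h₂ => simp only [add_tmul, map_add, h₁, h₂]
      | tmul y d =>
        induction q with
        | zero => simp
        | add q₁ q₂ h₁ h₂ => simp only [tmul_add, map_add, h₁, h₂]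
        | tmul w c =>
          have := LinearMap.congr_fun hm (d ⊗ₜ c)
          simp only [LinearMap.comp_apply, TensorProduct.map_tmul, LinearEquiv.coe_coe] at this
          simp only [F, TensorProduct.tensorTensorTensorComm_tmul, LinearMap.lTensor_tmul,
            LinearMap.comp_apply, LinearEquiv.coe_coe]
          rw [← this]
    have e : tensorCoact m X V (x ⊗ₜ v) = m.lTensor (X ⊗[k] V)
        (TensorProduct.tensorTensorTensorComm k X D V C (X.coact x ⊗ₜ V.coact v)) := by
      simp [tensorCoact]
    simp only [LinearMap.comp_apply, LinearEquiv.coe_coe]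
    rw [e, hl, hr, coassoc_apply, coassoc_apply]
  counit := by
    apply TensorProduct.ext'
    intro x v
    let F : (X ⊗[k] k) ⊗[k] (V ⊗[k] k) →ₗ[k] (X ⊗[k] V) ⊗[k] k :=
      (LinearMap.mul' k k).lTensor (X ⊗[k] V) ∘ₗ
        (TensorProduct.tensorTensorTensorComm k X k V k).toLinearMap
    have hr : ∀ (p : X ⊗[k] D) (q : V ⊗[k] C),
        cs.counit.lTensor (X ⊗[k] V) (m.lTensor (X ⊗[k] V)
          (TensorProduct.tensorTensorTensorComm k X D V C (p ⊗ₜ q))) =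
        F ((ds.counit.lTensor X p) ⊗ₜ
          (cs.counit.lTensor V q)) := by
      intro p q
      induction p with
      | zero => simp
      | add p₁ p₂ h₁ h₂ => simp only [add_tmul, map_add, h₁, h₂]
      | tmul y d =>
        induction q with
        | zero => simp
        | add q₁ q₂ h₁ h₂ => simp only [tmul_add, map_add, h₁, h₂]
        | tmul w c =>
          have := LinearMap.congr_fun hm' (d ⊗ₜ c)
          simp only [LinearMap.comp_apply, TensorProduct.map_tmul] at this
          simp only [F, TensorProduct.tensorTensorTensorComm_tmul, LinearMap.lTensor_tmul,
            LinearMap.comp_apply, LinearEquiv.coe_coe, LinearMap.mul'_apply, this]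
    have e : tensorCoact m X V (x ⊗ₜ v) = m.lTensor (X ⊗[k] V)
        (TensorProduct.tensorTensorTensorComm k X D V C (X.coact x ⊗ₜ V.coact v)) := by
      simp [tensorCoact]
    rw [LinearMap.comp_apply, e, hr, counit_apply, counit_apply]
    simp [F]

end Constructions

section Hopf

variable {k : Type u} {K : Type v} [Field k] [Ring K] [HopfAlgebra k K]

/-- The tensor product `X ⊗ Y` of two comodules over the Hopf algebra `K`. -/
abbrev tensorHopf (X Y : FDComod k K inferInstance) : FDComod k K inferInstance :=
  tensor (LinearMap.mul' k K) (Bialgebra.mulCoalgHom k K).map_comp_comul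
    (by
      apply TensorProduct.ext'
      intro a b
      exact Bialgebra.counit_mul (R := k) a b) X Y

/-- The unit comodule `k` of the Hopf algebra `K`, with coaction `x ↦ x ⊗ 1`. -/
abbrev unit (k : Type u) (K : Type v) [Field k] [Ring K] [HopfAlgebra k K] :
    FDComod k K inferInstance where
  carrier := k
  coact := (TensorProduct.mk k k K).flip 1
  coassoc := by
    ext
    simp [Algebra.TensorProduct.one_def]
  counit := by
    ext
    simp

/-- The action of `X ∈ Comod(K)` on `V ∈ Comod(K_ψ)`: the `K_ψ`-comodule `X ⊗ V` with coaction
`x ⊗ v ↦ x₀ ⊗ v₀ ⊗ x₁ v₁`.  For `K = 𝒪(H)` this is the `Rep(H)`-module structure of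
`Rep(H, ψ) = Corep(𝒪(H)_ψ)`. -/
abbrev tensorTwisted {ψ : K ⊗[k] K} (hψ : IsTwist k K ψ) (X : FDComod k K inferInstance)
    (V : FDComod k K (Twist.twistedCoalgebra hψ)) : FDComod k K (Twist.twistedCoalgebra hψ) :=
  tensor (LinearMap.mul' k K) Twist.map_mul_comul Twist.counit_mul_eq X V

/-- The action of `K*` on a right `K`-comodule: `ξ • x = x₀ ξ(x₁)`. -/
def act (X : FDComod k K inferInstance) : DualHopf k K →ₗ[k] (X →ₗ[k] X) :=
  LinearMap.lcomp k X X.coact ∘ₗ (LinearMap.llcomp k _ _ _ (TensorProduct.rid k X).toLinearMap) ∘ₗ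
    LinearMap.lTensorHom (R := k) X ∘ₗ (DualHopf.toDual k K).toLinearMap

theorem act_apply (X : FDComod k K inferInstance) (ξ : DualHopf k K) (x : X) :
    act X ξ x = TensorProduct.rid k X ((DualHopf.toDual k K ξ).lTensor X (X.coact x)) := rfl

/-- The action of `J ∈ K* ⊗ K*` on `X ⊗ Y`. -/
def act₂ (X Y : FDComod k K inferInstance) :
    DualHopf k K ⊗[k] DualHopf k K →ₗ[k] (X ⊗[k] Y →ₗ[k] X ⊗[k] Y) :=
  TensorProduct.homTensorHomMap (RingHom.id k) X Y X Y ∘ₗ TensorProduct.map (act X) (act Y)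

end Hopf

end FDComod

/-! ### Nondegeneracy -/

/-- A coalgebra is simple if it is nonzero and has no proper nonzero subcoalgebra. -/
def IsSimpleCoalgebra (k : Type u) {C : Type v} [Field k] [AddCommGroup C] [Module k C]
    (cs : Coalgebra k C) : Prop :=
  Nontrivial C ∧ ∀ D : Submodule k C,
    D.map cs.comul ≤ LinearMap.range (TensorProduct.map D.subtype D.subtype) → D = ⊥ ∨ D = ⊤

/-- A twist `ψ` for a Hopf algebra `K` is nondegenerate if the category of finite dimensional
comodules over the twisted coalgebra `K_ψ` is equivalent, as a `k`-linear category, to the category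
of finite dimensional vector spaces, i.e. if the coalgebra `K_ψ` is simple.  (Over an algebraically
closed field and for finite dimensional `K` the two conditions are equivalent; both are recorded.) -/
structure IsNondegenerate {k : Type u} {K : Type v} [Field k] [Ring K] [HopfAlgebra k K]
    {ψ : K ⊗[k] K} (hψ : IsTwist k K ψ) : Prop where
  corep_equiv_vec : ∃ F : FDComod k K (Twist.twistedCoalgebra hψ) ≌ FGModuleCat.{u} k,
    F.functor.Additive ∧ F.functor.Linear k
  simple : IsSimpleCoalgebra k (Twist.twistedCoalgebra hψ)

/-- A twist `ψ` for a finite dimensional Hopf algebra `K` corresponds to the twist `J` for `K*` if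
the `Comod(K)`-module categories `Corep(K_ψ)` and `Vec_J` are equivalent.  Here `Vec_J` is the
category of vector spaces, on which `X ∈ Comod(K)` acts by tensoring with the underlying vector
space of `X`, and whose associativity constraint comes from the tensor structure
`J : X ⊗ Y → X ⊗ Y` on the forgetful functor `Comod(K) → Vec`.

A linear functor out of `Vec` is `W ↦ W ⊗ V` for a comodule `V`, and a module structure on it is a
family of isomorphisms of comodules `s_X : X₀ ⊗ V ≅ X ⊗ V`, natural in `X`, where `X₀` is the vector
space underlying `X` with trivial coaction, such that `s_1 = id` and
`s_{X ⊗ Y} (J ⊗ id_V) = (id_X ⊗ s_Y) (s_X)₁₃` on `X ⊗ Y ⊗ V`. -/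
def CorrespondsTo {k : Type u} {K : Type v} [Field k] [Ring K] [HopfAlgebra k K]
    {ψ : K ⊗[k] K} (hψ : IsTwist k K ψ) (J : DualHopf k K ⊗[k] DualHopf k K) : Prop :=
  ∃ V : FDComod k K (Twist.twistedCoalgebra hψ),
    (FDComod.freeFunctor V).IsEquivalence ∧
    ∃ s : ∀ X : FDComod k K inferInstance, FDComod.free X V ≅ FDComod.tensorTwisted hψ X V,
      (∀ (X Y : FDComod k K inferInstance) (f : X ⟶ Y),
        (f.lin.rTensor V : X ⊗[k] V →ₗ[k] Y ⊗[k] V) ∘ₗ (s X).hom.lin =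
          (s Y).hom.lin ∘ₗ f.lin.rTensor V) ∧
      ((s (FDComod.unit k K)).hom.lin = LinearMap.id) ∧
      (∀ X Y : FDComod k K inferInstance,
        (TensorProduct.assoc k X Y V).toLinearMap ∘ₗ (s (FDComod.tensorHopf X Y)).hom.lin ∘ₗ
            (FDComod.act₂ X Y J).rTensor V =
          (s Y).hom.lin.lTensor X ∘ₗ (TensorProduct.leftComm k Y X V).toLinearMap ∘ₗ
            (s X).hom.lin.lTensor Y ∘ₗ (TensorProduct.leftComm k X Y V).toLinearMap ∘ₗ
              (TensorProduct.assoc k X Y V).toLinearMap)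

/-! ### Finite commutative group schemes -/

section Cartier

variable (k : Type u) (B : Type u) [Field k] [CommRing B] [HopfAlgebra k B]
  [FiniteDimensional k B]

/-- For `B = 𝒪(A)`, `A` a finite commutative group scheme, the coordinate algebra
`𝒪(A × Aᴰ) = 𝒪(A) ⊗ 𝒪(A)*`, where `Aᴰ` is the Cartier dual, `𝒪(Aᴰ) = k[A] = 𝒪(A)*`. -/
abbrev DoubleCoord : Type u := B ⊗[k] DualHopf k B

/-- The canonical element `∑ bᵢ ⊗ bᵢ*` of `𝒪(A) ⊗ 𝒪(A)*`. -/
def canonicalElement : B ⊗[k] DualHopf k B :=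
  (DualHopf.toDual k B).symm.toLinearMap.lTensor B (coevaluation k B 1)

/-- The canonical pairing `⟨f, a⟩` of `f ∈ Aᴰ(R) = Hom_alg(𝒪(A)*, R)` and
`a ∈ A(R) = Hom_alg(𝒪(A), R)`, for a commutative `k`-algebra `R`: it is `∑ a(bᵢ) f(bᵢ*)`. In other
words, `f` is viewed as the group-like element `∑ bᵢ ⊗ f(bᵢ*)` of `𝒪(A) ⊗ R`, i.e. as a character
`A_R → 𝔾ₘ`, and evaluated at `a`. -/
def cartierPairing {R : Type w} [CommRing R] [Algebra k R] (f : DualHopf k B →ₐ[k] R)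
    (a : B →ₐ[k] R) : R :=
  Algebra.TensorProduct.productMap a f (canonicalElement k B)

/-- The point of `A × Aᴰ` with components `a` and `f`. -/
def doublePoint {R : Type w} [CommRing R] [Algebra k R] (a : B →ₐ[k] R)
    (f : DualHopf k B →ₐ[k] R) : DoubleCoord k B →ₐ[k] R :=
  Algebra.TensorProduct.productMap a f

/-- The element `∑ (1 ⊗ bᵢ*) ⊗ (bᵢ ⊗ 1)` of `𝒪(A × Aᴰ) ⊗ 𝒪(A × Aᴰ)`, i.e. the function
`((a₁, f₁), (a₂, f₂)) ↦ ⟨f₁, a₂⟩`. -/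
def pairingCocycle : DoubleCoord k B ⊗[k] DoubleCoord k B :=
  Algebra.TensorProduct.map Algebra.TensorProduct.includeRight Algebra.TensorProduct.includeLeft
    (Algebra.TensorProduct.comm k B (DualHopf k B) (canonicalElement k B))

end Cartier

end

/-! Write `B` for 𝒪(A) and K for 𝒪(H) = B ⊗ B*. A bimultiplicative function on a commutative group
scheme is a 2-cocycle. Under B* ⊗ B ≅ Hom(B, B) the canonical element is the identity map, so
bimultiplicativity, normalization and invertibility (the inverse is the antipode) become identities
about id_B; this gives `isTwist_pairingCocycle`.

Nondegeneracy is a Stone–von Neumann argument. The group A × Aᴰ acts projectively on V = 𝒪(Aᴰ) = B*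
by multiplications and translations; in coalgebra terms, V is the right coideal 1 ⊗ B* of K_ψ. A
functional on K is the same as a linear map g : B* → B*, and it acts on V as the convolution id * g.
Since id has the antipode as convolution inverse, the action is injective, and a dimension count
makes it an isomorphism from (K_ψ)* onto End(V) (`heisenbergComod_dualAct_bijective`). Morita theory
for a matrix algebra then shows that W ↦ W ⊗ V is an equivalence from Vec
(`freeFunctor_isEquivalence`) and that the coalgebra is simple (`isSimpleCoalgebra_of_bijective`).
For a cohomologous cocycle, right multiplication by x⁻¹ is an isomorphism of twisted coalgebras
which carries V along.

For the twist J, the symmetric form p(b') p'(b) identifies K with its dual as a bialgebra, and J is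
the image of ψ; it is therefore a nondegenerate twist. The module equivalence uses the operators T(b
⊗ p) = (b ▷ ·) ∘ (S(p) ·) on V and s_X(x ⊗ v) = x₀ ⊗ T(x₁) v. Three properties of T suffice: it is
convolution invertible, so s_X is bijective (`exists_convInverse_hitAntipode`); it intertwines the
coaction of V, so s_X is a comodule map (`intertwines_heisenbergCoact`); and ∑ T(x₁ y₁) J(x₂, y₂) =
T(y) T(x), which is the compatibility with the tensor structure J
(`hitAntipode_mul_conv_dualTwist`). The second property survives right multiplication by x⁻¹ and the
other two do not involve ψ or its coaction, so one T and one J serve the whole cohomology class. -/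

noncomputable section

/-! ### Comodules as modules over the dual algebra -/

namespace FDComod

section DualAction

variable {k : Type u} {C : Type v} [Field k] [AddCommGroup C] [Module k C] {cs : Coalgebra k C}

/-- The convolution product of two functionals on a coalgebra. -/
def conv (cs : Coalgebra k C) (ξ η : Module.Dual k C) : Module.Dual k C :=
  LinearMap.mul' k k ∘ₗ TensorProduct.map ξ η ∘ₗ cs.comul

/-- The action `ξ • v = v₀ ξ(v₁)` of functionals on a comodule. -/
def dualAct (V : FDComod k C cs) : Module.Dual k C →ₗ[k] Module.End k V where
  toFun ξ := (TensorProduct.rid k V).toLinearMap ∘ₗ ξ.lTensor V ∘ₗ V.coact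
  map_add' ξ η := by simp only [LinearMap.lTensor_add, LinearMap.add_comp, LinearMap.comp_add]
  map_smul' c ξ := by simp only [LinearMap.lTensor_smul, LinearMap.smul_comp, LinearMap.comp_smul,
    RingHom.id_apply]

theorem dualAct_apply (V : FDComod k C cs) (ξ : Module.Dual k C) (v : V) :
    V.dualAct ξ v = TensorProduct.rid k V (ξ.lTensor V (V.coact v)) := rfl

theorem dualAct_counit (V : FDComod k C cs) : V.dualAct cs.counit = 1 := by
  ext v
  rw [dualAct_apply, V.counit_apply]
  simp

/-- Coassociativity of the coaction: both sides are v₀ ξ(v₁) η(v₂). A right comodule is thus a left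
module over the convolution algebra, with no reversal of order. -/
theorem dualAct_conv (V : FDComod k C cs) (ξ η : Module.Dual k C) :
    V.dualAct (conv cs ξ η) = V.dualAct ξ * V.dualAct η := by
  ext v
  have h1 : ∀ z : V ⊗[k] (C ⊗[k] C), TensorProduct.rid k V
      ((LinearMap.mul' k k ∘ₗ TensorProduct.map ξ η).lTensor V z) =
      TensorProduct.rid k V (ξ.lTensor V (TensorProduct.rid k (V ⊗[k] C)
        (η.lTensor (V ⊗[k] C) ((TensorProduct.assoc k V C C).symm z)))) := by
    intro z
    induction z with
    | zero => simp
    | add x y hx hy => simp only [map_add, hx, hy]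
    | tmul x y =>
      induction y with
      | zero => simp
      | add x y hx hy => simp only [map_add, tmul_add, hx, hy]
      | tmul y z =>
        simp only [LinearMap.lTensor_tmul, LinearMap.comp_apply, TensorProduct.map_tmul,
          LinearMap.mul'_apply, TensorProduct.rid_tmul, TensorProduct.assoc_symm_tmul,
          TensorProduct.smul_tmul', smul_smul]
  have h2 : ∀ z : V ⊗[k] C, TensorProduct.rid k (V ⊗[k] C)
        (η.lTensor (V ⊗[k] C) (V.coact.rTensor C z)) =
      V.coact (TensorProduct.rid k V (η.lTensor V z)) := by
    intro z
    induction z with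
    | zero => simp
    | add x y hx hy => simp only [map_add, hx, hy]
    | tmul x y => simp
  rw [dualAct_apply, conv, ← LinearMap.comp_assoc, LinearMap.lTensor_comp, LinearMap.comp_apply,
    ← V.coassoc_apply, h1, LinearEquiv.symm_apply_apply, h2]
  rfl

/-- The coordinate functionals of a basis of C already separate the elements; C may be infinite
dimensional, hence the finitely supported coordinates. -/
theorem tensor_ext_of_dual {W : Type w} [AddCommGroup W] [Module k W] {z z' : W ⊗[k] C}
    (h : ∀ ξ : Module.Dual k C, TensorProduct.rid k W (ξ.lTensor W z) =
      TensorProduct.rid k W (ξ.lTensor W z')) : z = z' := by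
  let b := Module.Free.chooseBasis k C
  apply (TensorProduct.equivFinsuppOfBasisRight (M := W) b).injective
  ext i
  have key : ∀ t : W ⊗[k] C, TensorProduct.equivFinsuppOfBasisRight b t i =
      TensorProduct.rid k W ((b.coord i).lTensor W t) := by
    intro t
    induction t with
    | zero => simp
    | add x y hx hy => simp only [map_add, Finsupp.add_apply, hx, hy]
    | tmul x y => simp
  rw [key, key, h]

/-- Functionals separate points of W ⊗ C, so comodule maps can be recognised on the module side.
`Hom.lin_dualAct` is the converse. -/
theorem comm_of_dualAct {V W : FDComod k C cs} (f : V →ₗ[k] W)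
    (h : ∀ ξ, f ∘ₗ V.dualAct ξ = W.dualAct ξ ∘ₗ f) :
    W.coact ∘ₗ f = f.rTensor C ∘ₗ V.coact := by
  ext v
  apply tensor_ext_of_dual
  intro ξ
  have e : ∀ z : V ⊗[k] C, TensorProduct.rid k W (ξ.lTensor W (f.rTensor C z)) =
      f (TensorProduct.rid k V (ξ.lTensor V z)) := by
    intro z
    induction z with
    | zero => simp
    | add x y hx hy => simp only [map_add, hx, hy]
    | tmul x y => simp
  rw [LinearMap.comp_apply, LinearMap.comp_apply, e]
  exact (LinearMap.congr_fun (h ξ) v).symm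

theorem Hom.lin_dualAct {V W : FDComod k C cs} (f : V ⟶ W) (ξ : Module.Dual k C) (v : V) :
    f.lin (V.dualAct ξ v) = W.dualAct ξ (f.lin v) := by
  have e : ∀ z : V ⊗[k] C, TensorProduct.rid k W (ξ.lTensor W (f.lin.rTensor C z)) =
      f.lin (TensorProduct.rid k V (ξ.lTensor V z)) := by
    intro z
    induction z with
    | zero => simp
    | add x y hx hy => simp only [map_add, hx, hy]
    | tmul x y => simp
  rw [dualAct_apply, dualAct_apply, ← e]
  congr 2
  exact (LinearMap.congr_fun f.comm v).symm

theorem free_dualAct (W : Type u) [AddCommGroup W] [Module k W] [FiniteDimensional k W]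
    (V : FDComod k C cs) (ξ : Module.Dual k C) :
    (free W V).dualAct ξ = (V.dualAct ξ).lTensor W := by
  apply TensorProduct.ext'
  intro x v
  have e : ∀ z : V ⊗[k] C, TensorProduct.rid k (W ⊗[k] V)
      (ξ.lTensor (W ⊗[k] V) ((TensorProduct.assoc k W V C).symm (x ⊗ₜ z))) =
      x ⊗ₜ (TensorProduct.rid k V (ξ.lTensor V z)) := by
    intro z
    induction z with
    | zero => simp
    | add x y hx hy => simp only [map_add, tmul_add, hx, hy]
    | tmul x y => simp
  exact e _

/-- A comodule morphism which is bijective is an isomorphism. -/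
def isoOfBijective {V W : FDComod k C cs} (f : V ⟶ W) (hf : Function.Bijective f.lin) :
    V ≅ W where
  hom := f
  inv :=
    ⟨(LinearEquiv.ofBijective f.lin hf).symm.toLinearMap, by
      apply comm_of_dualAct
      intro ξ
      ext w
      obtain ⟨v, rfl⟩ := hf.2 w
      have h : ∀ v, (LinearEquiv.ofBijective f.lin hf).symm (f.lin v) = v :=
        (LinearEquiv.ofBijective f.lin hf).symm_apply_apply
      simp only [LinearMap.comp_apply, LinearEquiv.coe_coe]
      rw [← Hom.lin_dualAct, h, h]⟩
  hom_inv_id := by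
    ext v
    exact (LinearEquiv.ofBijective f.lin hf).symm_apply_apply v
  inv_hom_id := by
    ext v
    exact (LinearEquiv.ofBijective f.lin hf).apply_symm_apply v

variable (V : FDComod k C cs)

instance : (freeFunctor V).Additive where
  map_add := by
    intro X Y f g
    ext1
    exact LinearMap.rTensor_add _ _ _

instance : (freeFunctor V).Linear k where
  map_smul := by
    intro X Y f r
    ext1
    exact LinearMap.rTensor_smul _ _ _

variable {V}

theorem freeFunctor_faithful [Nontrivial V] : (freeFunctor V).Faithful where
  map_injective := by
    intro X Y f g h
    have h' : f.hom.hom.rTensor V = g.hom.hom.rTensor V := congrArg Hom.lin h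
    obtain ⟨v, hv⟩ := exists_ne (0 : V)
    obtain ⟨ξ, hξ⟩ := Module.Projective.exists_dual_eq_one k hv
    ext x
    have := congrArg (fun t => TensorProduct.rid k Y (ξ.lTensor Y t))
      (LinearMap.congr_fun h' (x ⊗ₜ v))
    simpa [hξ] using this

/-- A comodule map commutes with id ⊗ T for every T in End(V). Applying this to the rank-one
operators which send v₀ to an arbitrary v shows that the map is determined by its values on x ⊗ v₀
and has the form f ⊗ id. -/
theorem freeFunctor_full [Nontrivial V] (hV : Function.Surjective V.dualAct) :
    (freeFunctor V).Full where
  map_surjective := by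
    intro X Y g
    obtain ⟨v₀, hv⟩ := exists_ne (0 : V)
    obtain ⟨ξ, hξ⟩ := Module.Projective.exists_dual_eq_one k hv
    let L : X ⊗[k] V →ₗ[k] Y ⊗[k] V := Hom.lin (V := free X V) (W := free Y V) g
    have hg : ∀ (T : Module.End k V) (t : X ⊗[k] V),
        L (T.lTensor X t) = T.lTensor Y (L t) := by
      intro T t
      obtain ⟨η, rfl⟩ := hV T
      rw [← free_dualAct, ← free_dualAct]
      exact Hom.lin_dualAct (V := free X V) (W := free Y V) g η t
    let f : X →ₗ[k] Y := (TensorProduct.rid k Y).toLinearMap ∘ₗ ξ.lTensor Y ∘ₗ L ∘ₗ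
      (TensorProduct.mk k X V).flip v₀
    refine ⟨FGModuleCat.ofHom f, ?_⟩
    ext1
    change f.rTensor V = L
    apply TensorProduct.ext'
    intro x v
    have h1 : x ⊗ₜ v = (ξ.smulRight v : Module.End k V).lTensor X (x ⊗ₜ v₀) := by simp [hξ]
    have h2 : ∀ t : Y ⊗[k] V, (ξ.smulRight v : Module.End k V).lTensor Y t =
        TensorProduct.rid k Y (ξ.lTensor Y t) ⊗ₜ v := by
      intro t
      induction t with
      | zero => simp
      | add x y hx hy => simp only [map_add, add_tmul, hx, hy]
      | tmul x y => simp [TensorProduct.smul_tmul]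
    rw [h1, hg, h2, LinearMap.lTensor_tmul, LinearMap.smulRight_apply, hξ, one_smul]
    rfl

/-- Morita equivalence by hand: the comodule M becomes an End(V)-module through `E`, and is
recovered from the image of a rank-one idempotent. -/
theorem freeFunctor_essSurj [Nontrivial V] (hV : Function.Bijective V.dualAct) :
    (freeFunctor V).EssSurj where
  mem_essImage := by
    intro M
    obtain ⟨v₀, hv⟩ := exists_ne (0 : V)
    obtain ⟨ξ₀, hξ⟩ := Module.Projective.exists_dual_eq_one k hv
    let e := LinearEquiv.ofBijective V.dualAct hV
    let E : Module.End k V →ₗ[k] Module.End k M := M.dualAct ∘ₗ e.symm.toLinearMap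
    have hE : ∀ ξ, E (V.dualAct ξ) = M.dualAct ξ := fun ξ =>
      congrArg M.dualAct (e.symm_apply_apply ξ)
    have hEmul : ∀ T T', E (T * T') = E T * E T' := by
      intro T T'
      obtain ⟨ξ, rfl⟩ := hV.2 T
      obtain ⟨η, rfl⟩ := hV.2 T'
      rw [← dualAct_conv, hE, hE, hE, dualAct_conv]
    have hEone : E 1 = 1 := by rw [← dualAct_counit, hE, dualAct_counit]
    let r : Module.Dual k V → V → Module.End k V := fun ξ v => ξ.smulRight v
    have hr : ∀ (ξ η : Module.Dual k V) (v w : V), r ξ v * r η w = ξ w • r η v := by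
      intro ξ η v w
      ext x
      simp [r, smul_smul, mul_comm]
    have hr' : ∀ (T : Module.End k V) (η : Module.Dual k V) (w : V), T * r η w = r η (T w) := by
      intro T η w
      ext x
      simp [r]
    -- As ξ₀(v₀) = 1, the operator `r ξ₀ v₀` is idempotent; its image in M is the multiplicity space
    -- of V.
    let W : Submodule k M := LinearMap.range (E (r ξ₀ v₀))
    let f : W ⊗[k] V →ₗ[k] M := TensorProduct.lift (LinearMap.mk₂ k
      (fun w v => E (r ξ₀ v) w)
      (by simp) (by simp)
      (by
        intro w v v'
        rw [show r ξ₀ (v + v') = r ξ₀ v + r ξ₀ v' by ext; simp [r], map_add, LinearMap.add_apply])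
      (by
        intro c w v
        rw [show r ξ₀ (c • v) = c • r ξ₀ v by ext; simp [r, smul_comm c], map_smul,
          LinearMap.smul_apply]))
    have hf : ∀ w v, f (w ⊗ₜ v) = E (r ξ₀ v) w := fun w v => rfl
    let F : free W V ⟶ M := ⟨f, by
      apply comm_of_dualAct
      intro ξ
      refine (congrArg (fun T => f ∘ₗ T) (free_dualAct W V ξ)).trans ?_
      apply TensorProduct.ext'
      intro w v
      change E (r ξ₀ (V.dualAct ξ v)) w = (M.dualAct ξ * E (r ξ₀ v)) w
      rw [← hE, ← hEmul, hr']⟩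
    let b := Module.finBasis k V
    have hmem : ∀ (ξ : Module.Dual k V) (m : M), E (r ξ v₀) m ∈ W := by
      intro ξ m
      refine ⟨E (r ξ v₀) m, ?_⟩
      rw [← Module.End.mul_apply, ← hEmul, hr, hξ, one_smul]
    -- The inverse splits m along 1 = ∑ r(bᵢ*, bᵢ): since r(bᵢ*, bᵢ) = r(ξ₀, bᵢ) r(bᵢ*, v₀), the
    -- component of m in W attached to bᵢ is E(r(bᵢ*, v₀)) m.
    let g : M →ₗ[k] W ⊗[k] V :=
      ∑ i, (TensorProduct.mk k W V).flip (b i) ∘ₗ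
        LinearMap.codRestrict W (E (r (b.coord i) v₀)) (hmem (b.coord i))
    have hfg : ∀ m, f (g m) = m := by
      intro m
      have h1 : ∑ i, r (b.coord i) (b i) = 1 := by
        ext x
        simp [r, b.sum_repr]
      simp only [g, LinearMap.sum_apply, map_sum, LinearMap.comp_apply, LinearMap.flip_apply,
        TensorProduct.mk_apply, hf, LinearMap.codRestrict_apply]
      conv_rhs => rw [← Module.End.one_apply (R := k) m, ← hEone, ← h1, map_sum]
      rw [LinearMap.sum_apply]
      refine Finset.sum_congr rfl fun i _ => ?_
      rw [← Module.End.mul_apply, ← hEmul, hr, hξ, one_smul]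
    have hgf : ∀ t, g (f t) = t := by
      intro t
      induction t with
      | zero => simp
      | add x y hx hy => simp only [map_add, hx, hy]
      | tmul w v =>
        have h2 : ∀ i, LinearMap.codRestrict W (E (r (b.coord i) v₀)) (hmem (b.coord i))
            (E (r ξ₀ v) w) = b.coord i v • w := by
          intro i
          ext1
          obtain ⟨w, m, rfl⟩ := w
          rw [LinearMap.codRestrict_apply, ← Module.End.mul_apply, ← hEmul, hr, map_smul,
            LinearMap.smul_apply, Submodule.coe_smul, ← Module.End.mul_apply, ← hEmul, hr, hξ,
            one_smul]
        simp only [g, LinearMap.sum_apply, LinearMap.comp_apply, LinearMap.flip_apply,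
          TensorProduct.mk_apply, hf, h2]
        simp only [TensorProduct.smul_tmul, ← TensorProduct.tmul_sum]
        simp [b.sum_repr]
    exact ⟨FGModuleCat.of k W, ⟨isoOfBijective F ⟨Function.LeftInverse.injective hgf,
      Function.RightInverse.surjective hfg⟩⟩⟩

theorem freeFunctor_isEquivalence [Nontrivial V] (hV : Function.Bijective V.dualAct) :
    (freeFunctor V).IsEquivalence where
  faithful := freeFunctor_faithful
  full := freeFunctor_full hV.2
  essSurj := freeFunctor_essSurj hV

/-- The functionals vanishing on a subcoalgebra form a two-sided ideal for convolution; the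
disjunction covers both sides at once. -/
theorem conv_eq_zero_of_mem {D : Submodule k C}
    (hD : D.map cs.comul ≤ LinearMap.range (TensorProduct.map D.subtype D.subtype))
    {ξ η : Module.Dual k C} (h : (∀ d ∈ D, ξ d = 0) ∨ ∀ d ∈ D, η d = 0) :
    ∀ d ∈ D, conv cs ξ η d = 0 := by
  intro d hd
  obtain ⟨t, ht⟩ := hD (Submodule.mem_map_of_mem hd)
  rw [conv, LinearMap.comp_apply, LinearMap.comp_apply, ← ht]
  clear ht
  induction t with
  | zero => simp
  | add x y hx hy => simp only [map_add, hx, hy, add_zero]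
  | tmul x y =>
    rcases h with h | h
    · simp [h x x.2]
    · simp [h y y.2]

/-- The annihilator of a proper subcoalgebra D is a nonzero two-sided ideal of C* ≅ End(V). A matrix
algebra is simple, so the annihilator is everything and D = 0. -/
theorem isSimpleCoalgebra_of_bijective [Nontrivial V] (hV : Function.Bijective V.dualAct) :
    IsSimpleCoalgebra k cs := by
  have hnt : Nontrivial (Module.Dual k C) := hV.2.nontrivial
  refine ⟨?_, ?_⟩
  · obtain ⟨ξ, hξ⟩ := exists_ne (0 : Module.Dual k C)
    by_contra h
    rw [not_nontrivial_iff_subsingleton] at h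
    exact hξ (LinearMap.ext fun x => by rw [Subsingleton.elim x 0, map_zero, map_zero])
  · intro D hD
    by_contra! hcon
    obtain ⟨hbot, htop⟩ := hcon
    obtain ⟨ξ, hξ, hξD⟩ := Submodule.exists_le_ker_of_lt_top D (lt_top_iff_ne_top.2 htop)
    have hT : V.dualAct ξ ≠ 0 := fun h => hξ (hV.1 (by rw [h, map_zero]))
    obtain ⟨v₁, hv₁⟩ : ∃ v₁, V.dualAct ξ v₁ ≠ 0 := by
      by_contra! h
      exact hT (LinearMap.ext h)
    obtain ⟨f, hf⟩ := Module.Projective.exists_dual_eq_one k hv₁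
    -- With T the operator of ξ and f(T v₁) = 1, the rank-one operator g ⊗ w factors as (f ⊗ w) T (g
    -- ⊗ v₁), so it lies in the ideal generated by T.
    have hrank : ∀ (g : Module.Dual k V) (w : V) (η : Module.Dual k C),
        V.dualAct η = g.smulRight w → ∀ d ∈ D, η d = 0 := by
      intro g w η hη
      obtain ⟨α, hα⟩ := hV.2 (f.smulRight w)
      obtain ⟨β, hβ⟩ := hV.2 (g.smulRight v₁)
      have : η = conv cs α (conv cs ξ β) := by
        apply hV.1
        rw [dualAct_conv, dualAct_conv, hη, hα, hβ]
        ext x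
        simp [hf]
      rw [this]
      exact conv_eq_zero_of_mem hD (Or.inr (conv_eq_zero_of_mem hD (Or.inl fun d hd => hξD hd)))
    -- Every endomorphism of V is a sum of rank-one operators, one for each basis vector.
    have hall : ∀ η : Module.Dual k C, ∀ d ∈ D, η d = 0 := by
      intro η d hd
      let b := Module.finBasis k V
      have hη : ∀ i, ∃ α, V.dualAct α = (b.coord i).smulRight (V.dualAct η (b i)) :=
        fun i => hV.2 _
      choose α hα using hη
      have : η = ∑ i, α i := by
        apply hV.1
        rw [map_sum]
        apply b.ext
        intro j
        simp [hα, Finsupp.single_apply]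
      rw [this, LinearMap.sum_apply]
      exact Finset.sum_eq_zero fun i _ => hrank _ _ _ (hα i) d hd
    refine hbot ((Submodule.eq_bot_iff _).2 fun d hd => ?_)
    by_contra h
    obtain ⟨η, hη⟩ := Module.Projective.exists_dual_eq_one k h
    exact one_ne_zero (hη.symm.trans (hall η d hd))

end DualAction

/-! ### Change of coalgebra along a coalgebra morphism -/

section Push

variable {k : Type u} {C : Type v} [Field k] [AddCommGroup C] [Module k C] {cs : Coalgebra k C}
  {D : Type w} [AddCommGroup D] [Module k D] {ds : Coalgebra k D}

/-- The comodule over `D` obtained from a comodule over `C` and a coalgebra morphism `f : C → D`. -/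
@[reducible]
def push (f : C →ₗ[k] D) (hf : ds.comul ∘ₗ f = TensorProduct.map f f ∘ₗ cs.comul)
    (hf' : ds.counit ∘ₗ f = cs.counit) (V : FDComod k C cs) : FDComod k D ds where
  carrier := V
  coact := f.lTensor V ∘ₗ V.coact
  coassoc := by
    ext v
    have h1 : ∀ z : V ⊗[k] C, TensorProduct.assoc k V D D
        ((f.lTensor V ∘ₗ V.coact).rTensor D (f.lTensor V z)) =
        (TensorProduct.map f f).lTensor V (TensorProduct.assoc k V C C (V.coact.rTensor C z)) := by
      intro z
      induction z with
      | zero => simp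
      | add x y hx hy => simp only [map_add, hx, hy]
      | tmul x y =>
        simp only [LinearMap.lTensor_tmul, LinearMap.rTensor_tmul, LinearMap.comp_apply]
        generalize V.coact x = q
        induction q with
        | zero => simp
        | add q₁ q₂ h₁ h₂ => simp only [add_tmul, map_add, h₁, h₂]
        | tmul q₁ q₂ => simp
    simp only [LinearMap.comp_apply, LinearEquiv.coe_coe]
    rw [h1, V.coassoc_apply]
    exact LinearMap.congr_fun ((LinearMap.lTensor_comp V _ _).symm.trans
      ((congrArg (LinearMap.lTensor V) hf.symm).trans (LinearMap.lTensor_comp V _ _))) (V.coact v)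
  counit := by
    rw [← LinearMap.comp_assoc, ← LinearMap.lTensor_comp, hf', V.counit]

variable (f : C →ₗ[k] D) (hf : ds.comul ∘ₗ f = TensorProduct.map f f ∘ₗ cs.comul)
    (hf' : ds.counit ∘ₗ f = cs.counit) (V : FDComod k C cs)

theorem push_dualAct (ξ : Module.Dual k D) :
    (push f hf hf' V).dualAct ξ = V.dualAct (ξ ∘ₗ f) := by
  ext v
  exact congrArg (TensorProduct.rid k V)
    (LinearMap.congr_fun (LinearMap.lTensor_comp V ξ f).symm (V.coact v))

/-- The two actions differ by the transpose of f, which is an isomorphism of dual spaces. -/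
theorem push_dualAct_bijective (h : Function.Bijective f) (hV : Function.Bijective V.dualAct) :
    Function.Bijective (push f hf hf' V).dualAct := by
  have : ⇑(push f hf hf' V).dualAct = V.dualAct ∘ (LinearEquiv.ofBijective f h).dualMap := by
    ext1 ξ
    exact push_dualAct f hf hf' V ξ
  rw [this]
  exact hV.comp (LinearEquiv.bijective _)

end Push

end FDComod

/-- A twist `ψ` is nondegenerate as soon as `K_ψ` is the coefficient coalgebra of a comodule on
which the dual algebra acts through all endomorphisms. -/
theorem isNondegenerate_of_bijective {k : Type u} {K : Type u} [Field k] [Ring K] [HopfAlgebra k K]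
    {ψ : K ⊗[k] K} (hψ : IsTwist k K ψ) (V : FDComod k K (Twist.twistedCoalgebra hψ))
    [Nontrivial V] (hV : Function.Bijective V.dualAct) : IsNondegenerate hψ where
  corep_equiv_vec := by
    have := FDComod.freeFunctor_isEquivalence hV
    let e := (FDComod.freeFunctor V).asEquivalence
    have : e.functor.Additive := inferInstanceAs (FDComod.freeFunctor V).Additive
    have : e.functor.Linear k := inferInstanceAs ((FDComod.freeFunctor V).Linear k)
    exact ⟨e.symm, inferInstanceAs e.inverse.Additive, inferInstanceAs (e.inverse.Linear k)⟩
  simple := FDComod.isSimpleCoalgebra_of_bijective hV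

/-! ### Tensors with a dual Hopf algebra as linear maps -/

/-- Commutativity enters as a hypothesis because `DualHopf` carries only a `Ring` structure: its
product commutes thanks to cocommutativity of B. -/
theorem tensor_mul_comm {k A A' : Type*} [Field k] [Ring A] [Algebra k A] [Ring A'] [Algebra k A']
    (h : ∀ x y : A, x * y = y * x) (h' : ∀ x y : A', x * y = y * x) (x y : A ⊗[k] A') :
    x * y = y * x := by
  induction x with
  | zero => simp
  | add x₁ x₂ h₁ h₂ => rw [add_mul, mul_add, h₁, h₂]
  | tmul a a' =>
    induction y with
    | zero => simp
    | add y₁ y₂ h₁ h₂ => rw [add_mul, mul_add, h₁, h₂]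
    | tmul b b' =>
      rw [Algebra.TensorProduct.tmul_mul_tmul, Algebra.TensorProduct.tmul_mul_tmul, h, h']

namespace DualHopf

variable {k : Type u} {B : Type v} [Field k] [CommRing B] [HopfAlgebra k B]

theorem toDual_ext {ξ η : DualHopf k B} (h : ∀ a, toDual k B ξ a = toDual k B η a) : ξ = η :=
  (toDual k B).injective (LinearMap.ext h)

theorem mul_comm' [Coalgebra.IsCocomm k B] (ξ η : DualHopf k B) : ξ * η = η * ξ := by
  apply toDual_ext
  intro a
  rw [toDual_mul_apply, toDual_mul_apply]
  conv_lhs => rw [← Coalgebra.comm_comul k a]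
  generalize Coalgebra.comul (R := k) a = z
  induction z with
  | zero => simp
  | add x y hx hy => simp only [map_add, hx, hy]
  | tmul x y => simp [mul_comm]

/-- The transpose action `(b ▷ ξ)(y) = ξ(b y)` of `B` on `B*`. -/
def hit : B →ₗ[k] Module.End k (DualHopf k B) where
  toFun b := (toDual k B).symm.toLinearMap ∘ₗ (LinearMap.mulLeft k b).dualMap ∘ₗ
    (toDual k B).toLinearMap
  map_add' b b' := by
    ext ξ
    apply toDual_ext
    intro y
    simp [add_mul]
  map_smul' c b := by
    ext ξ
    apply toDual_ext
    intro y
    simp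

@[simp]
theorem toDual_hit (b : B) (ξ : DualHopf k B) (y : B) :
    toDual k B (hit b ξ) y = toDual k B ξ (b * y) := by
  simp [hit]

theorem hit_mul (b b' : B) : hit (k := k) (b * b') = hit b * hit b' := by
  ext ξ
  apply toDual_ext
  intro y
  simp only [toDual_hit, Module.End.mul_apply]
  congr 1
  ring

theorem hit_one : hit (k := k) (1 : B) = 1 := by
  ext ξ
  apply toDual_ext
  intro y
  simp

theorem commute_hit (b b' : B) : hit (k := k) b * hit b' = hit b' * hit b := by
  rw [← hit_mul, ← hit_mul, mul_comm]

/-! ### The identification of B* ⊗ R with Hom(B, R) -/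

section Contract

variable {R : Type w} [Ring R] [Algebra k R]

/-- The linear map `y ↦ ∑ βᵢ(y) rᵢ` attached to `∑ βᵢ ⊗ rᵢ ∈ B* ⊗ R`. -/
def contract : DualHopf k B ⊗[k] R →ₗ[k] (B →ₗ[k] R) :=
  dualTensorHom k B R ∘ₗ (toDual k B).toLinearMap.rTensor R

@[simp]
theorem contract_tmul (β : DualHopf k B) (r : R) (y : B) :
    contract (β ⊗ₜ[k] r) y = toDual k B β y • r := by
  simp [contract]

theorem contract_bijective [FiniteDimensional k B] :
    Function.Bijective (contract (k := k) (B := B) (R := R)) := by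
  have h : Function.Bijective ((toDual k B).toLinearMap.rTensor R) :=
    ((toDual k B).rTensor R).bijective
  exact (dualTensorHomEquiv k B R).bijective.comp h

theorem contract_ext [FiniteDimensional k B] {z z' : DualHopf k B ⊗[k] R}
    (h : ∀ y, contract z y = contract z' y) : z = z' :=
  contract_bijective.1 (LinearMap.ext h)

theorem contract_one (y : B) :
    contract (1 : DualHopf k B ⊗[k] R) y = algebraMap k R (Coalgebra.counit y) := by
  rw [Algebra.TensorProduct.one_def, contract_tmul, toDual_one, Algebra.algebraMap_eq_smul_one]

/-- The product of B* is dual to the coproduct of B, so the algebra B* ⊗ R becomes Hom(B, R) with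
convolution. Identities in B* ⊗ R are checked below in this form. -/
theorem contract_mul (z z' : DualHopf k B ⊗[k] R) (y : B) :
    contract (z * z') y = LinearMap.mul' k R
      (TensorProduct.map (contract z) (contract z') (Coalgebra.comul y)) := by
  induction z with
  | zero => simp
  | add z₁ z₂ h₁ h₂ =>
    simp only [add_mul, map_add, LinearMap.add_apply, h₁, h₂, TensorProduct.map_add_left]
  | tmul β r =>
    induction z' with
    | zero => simp
    | add z₁ z₂ h₁ h₂ =>
      simp only [mul_add, map_add, LinearMap.add_apply, h₁, h₂, TensorProduct.map_add_right]
    | tmul β' r' =>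
      rw [Algebra.TensorProduct.tmul_mul_tmul, contract_tmul, toDual_mul_apply]
      generalize Coalgebra.comul (R := k) y = t
      induction t with
      | zero => simp
      | add x y hx hy => simp only [map_add, add_smul, hx, hy]
      | tmul x y =>
        simp only [TensorProduct.map_tmul, LinearMap.mul'_apply, contract_tmul,
          smul_mul_smul_comm]

theorem contract_map {R' : Type*} [Ring R'] [Algebra k R'] (f : R →ₐ[k] R')
    (z : DualHopf k B ⊗[k] R) (y : B) :
    contract (Algebra.TensorProduct.map (AlgHom.id k _) f z) y = f (contract z y) := by
  induction z with
  | zero => simp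
  | add z₁ z₂ h₁ h₂ => simp only [map_add, LinearMap.add_apply, h₁, h₂]
  | tmul β r => simp

theorem contract_one_tmul_mul (r : R) (z : DualHopf k B ⊗[k] R) (y : B) :
    contract ((1 ⊗ₜ r) * z) y = r * contract z y := by
  induction z with
  | zero => simp
  | add z₁ z₂ h₁ h₂ => simp only [mul_add, map_add, LinearMap.add_apply, h₁, h₂]
  | tmul β r => simp

theorem contract_mul_one_tmul (r : R) (z : DualHopf k B ⊗[k] R) (y : B) :
    contract (z * (1 ⊗ₜ r)) y = contract z y * r := by
  induction z with
  | zero => simp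
  | add z₁ z₂ h₁ h₂ => simp only [add_mul, map_add, LinearMap.add_apply, h₁, h₂]
  | tmul β r => simp

theorem contract_rTensor_hit (b : B) (z : DualHopf k B ⊗[k] R) (y : B) :
    contract ((hit b).rTensor R z) y = contract z (b * y) := by
  induction z with
  | zero => simp
  | add z₁ z₂ h₁ h₂ => simp only [map_add, LinearMap.add_apply, h₁, h₂]
  | tmul β r => simp

end Contract

theorem toDual_contract (z : DualHopf k B ⊗[k] DualHopf k B) (a b : B) :
    toDual k B (contract z a) b = pair k B z (a ⊗ₜ b) := by
  induction z with
  | zero => simp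
  | add z₁ z₂ h₁ h₂ => simp only [map_add, LinearMap.add_apply, h₁, h₂]
  | tmul β r => simp

/-- The evaluation pairing `b ⊗ p ↦ p(b)`. -/
def eval : B ⊗[k] DualHopf k B →ₗ[k] k :=
  contractLeft k B ∘ₗ (TensorProduct.comm k B _).toLinearMap ∘ₗ
    (toDual k B).toLinearMap.lTensor B

@[simp]
theorem eval_tmul (b : B) (p : DualHopf k B) : eval (b ⊗ₜ[k] p) = toDual k B p b := by
  simp [eval]

/-- `∑ S(b₁) f(b₂) b₃ = f(b)`. -/
theorem sum_antipode_mul_smul [Coalgebra.IsCocomm k B] (f : B →ₗ[k] k) (b : B) :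
    LinearMap.mul' k B (((TensorProduct.rid k B).toLinearMap ∘ₗ
      TensorProduct.map (HopfAlgebra.antipode k) f ∘ₗ Coalgebra.comul).rTensor B
        (Coalgebra.comul b)) = algebraMap k B (f b) := by
  let l : B ⊗[k] (B ⊗[k] B) →ₗ[k] B := (TensorProduct.rid k B).toLinearMap ∘ₗ
    TensorProduct.map (LinearMap.mul' k B ∘ₗ (HopfAlgebra.antipode k).rTensor B) f ∘ₗ
      (TensorProduct.assoc k B B B).symm.toLinearMap
  have h1 : ∀ s : B ⊗[k] B, LinearMap.mul' k B (((TensorProduct.rid k B).toLinearMap ∘ₗ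
      TensorProduct.map (HopfAlgebra.antipode k) f ∘ₗ Coalgebra.comul).rTensor B s) =
      l ((TensorProduct.comm k B B).toLinearMap.lTensor B
        (TensorProduct.assoc k B B B (Coalgebra.comul.rTensor B s))) := by
    intro s
    induction s with
    | zero => simp
    | add z₁ z₂ h₁ h₂ => simp only [map_add, h₁, h₂]
    | tmul x y =>
      simp only [LinearMap.rTensor_tmul, LinearMap.comp_apply, LinearMap.mul'_apply]
      generalize Coalgebra.comul (R := k) x = t
      induction t with
      | zero => simp
      | add z₁ z₂ h₁ h₂ => simp only [map_add, add_tmul, add_mul, h₁, h₂]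
      | tmul x x' => simp [l]
  -- Cocommutativity interchanges b₂ and b₃, which brings S(b₁) next to the factor it cancels.
  have h2 : ∀ s : B ⊗[k] B, (TensorProduct.comm k B B).toLinearMap.lTensor B
      (Coalgebra.comul.lTensor B s) = Coalgebra.comul.lTensor B s := by
    intro s
    rw [← LinearMap.comp_apply, ← LinearMap.lTensor_comp, Coalgebra.comm_comp_comul]
  rw [h1, Coalgebra.coassoc_apply, h2, ← Coalgebra.coassoc_apply]
  simp only [l, LinearMap.comp_apply, LinearEquiv.coe_coe, LinearEquiv.symm_apply_apply]
  have h3 : ∀ s : B ⊗[k] B, TensorProduct.rid k B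
      (TensorProduct.map (LinearMap.mul' k B ∘ₗ (HopfAlgebra.antipode k).rTensor B) f
        (Coalgebra.comul.rTensor B s)) =
      algebraMap k B (f (TensorProduct.lid k B (Coalgebra.counit.rTensor B s))) := by
    intro s
    induction s with
    | zero => simp
    | add z₁ z₂ h₁ h₂ => simp only [map_add, h₁, h₂]
    | tmul x y =>
      simp only [LinearMap.rTensor_tmul, TensorProduct.map_tmul, LinearMap.comp_apply,
        HopfAlgebra.mul_antipode_rTensor_comul_apply]
      simp [Algebra.algebraMap_eq_smul_one, smul_smul, mul_comm]
  rw [h3, Coalgebra.rTensor_counit_comul]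
  simp

variable [FiniteDimensional k B]

theorem contract_comul (v : DualHopf k B) (y : B) :
    contract (Coalgebra.comul v) y = hit y v := by
  apply toDual_ext
  intro z
  rw [toDual_contract, pair_comul, toDual_hit]

theorem toDual_antipode (p : DualHopf k B) (y : B) :
    toDual k B (HopfAlgebra.antipode k p) y = toDual k B p (HopfAlgebra.antipode k y) := rfl

/-- The operators `b ⊗ p ↦ (b ▷ ·) ∘ (S(p) ·)` on `B*`. -/
def hitAntipode : B ⊗[k] DualHopf k B →ₗ[k] Module.End k (DualHopf k B) :=
  LinearMap.mul' k _ ∘ₗ TensorProduct.map hit (LinearMap.mul k _ ∘ₗ HopfAlgebra.antipode k)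

@[simp]
theorem hitAntipode_tmul (b : B) (p v : DualHopf k B) :
    hitAntipode (b ⊗ₜ[k] p) v = hit b (HopfAlgebra.antipode k p * v) := by
  simp [hitAntipode]

theorem hitAntipode_one : hitAntipode (k := k) (1 : B ⊗[k] DualHopf k B) = 1 := by
  ext v
  rw [Algebra.TensorProduct.one_def, hitAntipode_tmul, HopfAlgebra.antipode_one, one_mul, hit_one]

/-- `∑ p₂(b₂) b₁ ▷ (S(p₁) v) = S(p) (b ▷ v)`. -/
theorem hitAntipode_conv_eval [Coalgebra.IsCocomm k B] (b : B) (p v : DualHopf k B) :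
    TensorProduct.rid k _ (TensorProduct.map hitAntipode eval
      (Coalgebra.comul (R := k) (b ⊗ₜ[k] p))) v = HopfAlgebra.antipode k p * hit b v := by
  apply toDual_ext
  intro y
  -- This is x ↦ ∑ S((xy)₁) v((xy)₂). After evaluation at y the left side is p applied to ∑ m(b₁)
  -- b₂.
  let m : B →ₗ[k] B := (TensorProduct.rid k B).toLinearMap ∘ₗ
    TensorProduct.map (HopfAlgebra.antipode k) (toDual k B v) ∘ₗ Coalgebra.comul ∘ₗ
      LinearMap.mulRight k y
  have h : ∀ (s : B ⊗[k] B) (t : DualHopf k B ⊗[k] DualHopf k B),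
      toDual k B (TensorProduct.rid k (Module.End k (DualHopf k B))
        (TensorProduct.map hitAntipode eval
          (TensorProduct.tensorTensorTensorComm k _ _ _ _ (s ⊗ₜ t))) v) y =
      pair k B t (m.rTensor B s) := by
    intro s t
    induction s with
    | zero => simp
    | add z₁ z₂ h₁ h₂ => simp only [map_add, add_tmul, LinearMap.add_apply, h₁, h₂]
    | tmul x x' =>
      induction t with
      | zero => simp
      | add z₁ z₂ h₁ h₂ => simp only [map_add, tmul_add, LinearMap.add_apply, h₁, h₂]
      | tmul p q =>
        simp only [TensorProduct.tensorTensorTensorComm_tmul, TensorProduct.map_tmul, eval_tmul,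
          TensorProduct.rid_tmul, LinearMap.smul_apply, hitAntipode_tmul, map_smul, toDual_hit,
          toDual_mul_apply, LinearMap.rTensor_tmul, pair_tmul, m, LinearMap.comp_apply,
          LinearMap.mulRight_apply, smul_eq_mul]
        rw [mul_comm]
        congr 1
        generalize Coalgebra.comul (R := k) (x * y) = r
        induction r with
        | zero => simp
        | add z₁ z₂ h₁ h₂ => simp only [map_add, h₁, h₂]
        | tmul a b => simp [toDual_antipode, mul_comm]
  rw [TensorProduct.comul_tmul]
  refine (h _ _).trans ?_
  rw [pair_comul', LinearMap.comp_apply, toDual_mul_apply]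
  -- Since Δ(xy) = Δ(x) Δ(y), the tensor Δ(y) may be replaced by any r. For r = y₁ ⊗ y₂ the factor
  -- S(y₁) comes out, and what remains is `sum_antipode_mul_smul` for the functional v(· y₂).
  have h2 : ∀ r : B ⊗[k] B, LinearMap.mul' k B (((TensorProduct.rid k B).toLinearMap ∘ₗ
      TensorProduct.map (HopfAlgebra.antipode k) (toDual k B v) ∘ₗ LinearMap.mulRight k r ∘ₗ
        Coalgebra.comul).rTensor B (Coalgebra.comul b)) =
      TensorProduct.rid k B
        (TensorProduct.map (HopfAlgebra.antipode k) (toDual k B (hit b v)) r) := by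
    intro r
    induction r with
    | zero => simp
    | add z₁ z₂ h₁ h₂ =>
      rw [map_add, map_add, ← h₁, ← h₂, ← map_add, ← LinearMap.add_apply, ← LinearMap.rTensor_add]
      congr 3
      ext x
      simp [mul_add]
    | tmul y₁ y₂ =>
      have e : (TensorProduct.rid k B).toLinearMap ∘ₗ
          TensorProduct.map (HopfAlgebra.antipode k) (toDual k B v) ∘ₗ
            LinearMap.mulRight k (y₁ ⊗ₜ[k] y₂) ∘ₗ Coalgebra.comul =
          LinearMap.mulRight k (HopfAlgebra.antipode k y₁) ∘ₗ
            (TensorProduct.rid k B).toLinearMap ∘ₗ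
              TensorProduct.map (HopfAlgebra.antipode k)
                (toDual k B v ∘ₗ LinearMap.mulRight k y₂) ∘ₗ Coalgebra.comul := by
        ext x
        simp only [LinearMap.comp_apply, LinearEquiv.coe_coe, LinearMap.mulRight_apply]
        generalize Coalgebra.comul (R := k) x = r
        induction r with
        | zero => simp
        | add z₁ z₂ h₁ h₂ => simp only [map_add, add_mul, h₁, h₂]
        | tmul a b => simp [HopfAlgebra.antipode_mul_distrib]
      have e2 : ∀ s : B ⊗[k] B, ∀ g : B →ₗ[k] B, LinearMap.mul' k B
          ((LinearMap.mulRight k (HopfAlgebra.antipode k y₁) ∘ₗ g).rTensor B s) =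
          HopfAlgebra.antipode k y₁ * LinearMap.mul' k B (g.rTensor B s) := by
        intro s g
        induction s with
        | zero => simp
        | add z₁ z₂ h₁ h₂ => simp only [map_add, mul_add, h₁, h₂]
        | tmul a b =>
          simp only [LinearMap.rTensor_tmul, LinearMap.mul'_apply, LinearMap.comp_apply,
            LinearMap.mulRight_apply]
          ring
      rw [e, e2, sum_antipode_mul_smul]
      simp [Algebra.smul_def, mul_comm]
  have h3 : m = (TensorProduct.rid k B).toLinearMap ∘ₗ
      TensorProduct.map (HopfAlgebra.antipode k) (toDual k B v) ∘ₗ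
        LinearMap.mulRight k (Coalgebra.comul y) ∘ₗ Coalgebra.comul := by
    ext x
    simp [m]
  rw [h3, h2]
  generalize Coalgebra.comul (R := k) y = r
  induction r with
  | zero => simp
  | add z₁ z₂ h₁ h₂ => simp only [map_add, h₁, h₂]
  | tmul a c => simp [toDual_antipode, mul_comm]

/-- `∑ (1 ⊗ p₁) Δ(S(p₂)) = S(p) ⊗ 1`. -/
theorem one_tmul_mul_comul_antipode (p : DualHopf k B) :
    LinearMap.mul' k _ (TensorProduct.map
      (Algebra.TensorProduct.includeRight : DualHopf k B →ₐ[k] DualHopf k B ⊗[k] DualHopf k B).toLinearMap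
      (Coalgebra.comul ∘ₗ HopfAlgebra.antipode k) (Coalgebra.comul p)) =
    HopfAlgebra.antipode k p ⊗ₜ[k] 1 := by
  apply contract_ext
  intro y
  apply toDual_ext
  intro z
  have h : ∀ t : DualHopf k B ⊗[k] DualHopf k B, toDual k B (contract (LinearMap.mul' k _
      (TensorProduct.map (Algebra.TensorProduct.includeRight :
        DualHopf k B →ₐ[k] DualHopf k B ⊗[k] DualHopf k B).toLinearMap
      (Coalgebra.comul ∘ₗ HopfAlgebra.antipode k) t)) y) z =
      pair k B t ((HopfAlgebra.antipode k ∘ₗ LinearMap.mulLeft k y).lTensor B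
        (Coalgebra.comul z)) := by
    intro t
    induction t with
    | zero => simp
    | add z₁ z₂ h₁ h₂ => simp only [map_add, LinearMap.add_apply, h₁, h₂]
    | tmul p q =>
      simp only [TensorProduct.map_tmul, LinearMap.mul'_apply, AlgHom.toLinearMap_apply,
        Algebra.TensorProduct.includeRight_apply, contract_one_tmul_mul, LinearMap.comp_apply,
        contract_comul, toDual_mul_apply]
      generalize Coalgebra.comul (R := k) z = s
      induction s with
      | zero => simp
      | add z₁ z₂ h₁ h₂ => simp only [map_add, h₁, h₂]
      | tmul a b => simp [toDual_antipode]
  rw [h, pair_comul', contract_tmul, map_smul, LinearMap.smul_apply, toDual_one,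
    toDual_antipode, LinearMap.comp_apply,
    smul_eq_mul]
  -- On y ⊗ z the claim reads p(∑ z₁ S(y z₂)) = p(S(y)) ε(z): pull out S(y), then cancel z₁ S(z₂).
  have h2 : LinearMap.mul' k B ((HopfAlgebra.antipode k ∘ₗ LinearMap.mulLeft k y).lTensor B
        (Coalgebra.comul z)) =
      HopfAlgebra.antipode k y * LinearMap.mul' k B ((HopfAlgebra.antipode k).lTensor B
        (Coalgebra.comul z)) := by
    generalize Coalgebra.comul (R := k) z = s
    induction s with
    | zero => simp
    | add z₁ z₂ h₁ h₂ => simp only [map_add, mul_add, h₁, h₂]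
    | tmul a b =>
      simp only [LinearMap.lTensor_tmul, LinearMap.mul'_apply, LinearMap.comp_apply,
        LinearMap.mulLeft_apply, HopfAlgebra.antipode_mul_distrib]
      ring
  rw [h2, HopfAlgebra.mul_antipode_lTensor_comul_apply, mul_comm, ← Algebra.smul_def, map_smul,
    smul_eq_mul, mul_comm]

end DualHopf

/-! ### The pairing cocycle -/

theorem doubleCoord_mul_comm {k B : Type u} [Field k] [CommRing B] [HopfAlgebra k B]
    [Coalgebra.IsCocomm k B] (x y : DoubleCoord k B) : x * y = y * x :=
  tensor_mul_comm mul_comm DualHopf.mul_comm' x y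

section PairingCocycle

open DualHopf

variable {k : Type u} {B : Type u} [Field k] [CommRing B] [HopfAlgebra k B]
  [FiniteDimensional k B]

variable (k B) in
/-- The inclusion of `𝒪(A)` in `𝒪(A × Aᴰ)`. -/
abbrev inclFst : B →ₐ[k] DoubleCoord k B := Algebra.TensorProduct.includeLeft

variable (k B) in
/-- The inclusion of `𝒪(Aᴰ)` in `𝒪(A × Aᴰ)`. -/
abbrev inclSnd : DualHopf k B →ₐ[k] DoubleCoord k B := Algebra.TensorProduct.includeRight

variable (k B) in
/-- The canonical element with its two tensor factors exchanged. -/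
def swappedCanonical : DualHopf k B ⊗[k] B :=
  Algebra.TensorProduct.comm k B (DualHopf k B) (canonicalElement k B)

/-- The canonical element is the identity map of B; every later property of the pairing rests on
this. -/
theorem contract_swappedCanonical (y : B) : contract (swappedCanonical k B) y = y := by
  rw [swappedCanonical, canonicalElement, coevaluation_apply_one]
  simp only [map_sum, LinearMap.sum_apply, LinearMap.lTensor_tmul, LinearEquiv.coe_coe,
    Algebra.TensorProduct.comm_tmul, contract_tmul, LinearEquiv.apply_symm_apply,
    Module.Basis.coord_apply]
  exact Module.Basis.sum_repr _ y

theorem pairingCocycle_eq : pairingCocycle k B =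
    Algebra.TensorProduct.map (inclSnd k B) (inclFst k B) (swappedCanonical k B) := rfl

theorem productMap_pairingCocycle {R : Type w} [CommRing R] [Algebra k R] (a₁ a₂ : B →ₐ[k] R)
    (f₁ f₂ : DualHopf k B →ₐ[k] R) :
    Algebra.TensorProduct.productMap (doublePoint k B a₁ f₁) (doublePoint k B a₂ f₂)
      (pairingCocycle k B) = cartierPairing k B f₁ a₂ := by
  rw [pairingCocycle, cartierPairing]
  induction canonicalElement k B with
  | zero => simp
  | add x y hx hy => simp only [map_add, hx, hy]
  | tmul b p => simp [doublePoint, mul_comm]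

/-- Multiplicativity of ⟨f, a⟩ in f. Contracted against y and y', both sides give y y'. -/
theorem swappedCanonical_comul_left :
    Algebra.TensorProduct.assoc k k k _ _ _
      (Algebra.TensorProduct.map (Bialgebra.comulAlgHom k (DualHopf k B)) (AlgHom.id k B)
        (swappedCanonical k B)) =
    Algebra.TensorProduct.map (AlgHom.id k _) Algebra.TensorProduct.includeRight
      (swappedCanonical k B) * (1 ⊗ₜ swappedCanonical k B) := by
  apply contract_ext
  intro y
  apply contract_ext
  intro y'
  have h : ∀ z : DualHopf k B ⊗[k] B, contract (contract (Algebra.TensorProduct.assoc k k k _ _ _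
      (Algebra.TensorProduct.map (Bialgebra.comulAlgHom k (DualHopf k B)) (AlgHom.id k B) z)) y) y'
      = contract z (y * y') := by
    intro z
    induction z with
    | zero => simp
    | add z₁ z₂ h₁ h₂ => simp only [map_add, LinearMap.add_apply, h₁, h₂]
    | tmul β b =>
      rw [contract_tmul, ← pair_comul]
      simp only [Algebra.TensorProduct.map_tmul, Bialgebra.comulAlgHom_apply, AlgHom.id_apply]
      generalize Coalgebra.comul (R := k) β = t
      induction t with
      | zero => simp
      | add z₁ z₂ h₁ h₂ => simp only [map_add, add_tmul, LinearMap.add_apply, add_smul, h₁, h₂]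
      | tmul p q => simp [mul_smul]
  rw [h, contract_mul_one_tmul, contract_map, contract_swappedCanonical,
    contract_swappedCanonical, Algebra.TensorProduct.includeRight_apply, contract_one_tmul_mul,
    contract_swappedCanonical]

/-- Multiplicativity of ⟨f, a⟩ in a. As maps B → B ⊗ B, the left side is Δ and the right side is the
convolution of the two inclusions, which is again Δ. -/
theorem swappedCanonical_comul_right :
    Algebra.TensorProduct.map (AlgHom.id k (DualHopf k B)) (Bialgebra.comulAlgHom k B)
      (swappedCanonical k B) =
    Algebra.TensorProduct.map (AlgHom.id k _) Algebra.TensorProduct.includeLeft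
      (swappedCanonical k B) *
    Algebra.TensorProduct.map (AlgHom.id k _) Algebra.TensorProduct.includeRight
      (swappedCanonical k B) := by
  apply contract_ext
  intro y
  have h (f : B →ₐ[k] B ⊗[k] B) : contract (Algebra.TensorProduct.map (AlgHom.id k _) f
      (swappedCanonical k B)) = f.toLinearMap := by
    ext y
    rw [contract_map, contract_swappedCanonical]
    rfl
  rw [contract_mul, h, h, h, AlgHom.toLinearMap_apply, Bialgebra.comulAlgHom_apply]
  generalize Coalgebra.comul (R := k) y = t
  induction t with
  | zero => simp
  | add z₁ z₂ h₁ h₂ => simp only [map_add, ← h₁, ← h₂]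
  | tmul p q => simp

/-- The identity map is convolution invertible, with the antipode as inverse. -/
theorem isUnit_swappedCanonical : IsUnit (swappedCanonical k B) := by
  obtain ⟨z, hz⟩ := contract_bijective.2 (HopfAlgebra.antipode k (A := B))
  have h : contract (swappedCanonical k B) = LinearMap.id :=
    LinearMap.ext contract_swappedCanonical
  refine isUnit_iff_exists.2 ⟨z, ?_, ?_⟩
  · apply contract_ext
    intro y
    rw [contract_mul, h, hz, contract_one]
    exact HopfAlgebra.mul_antipode_lTensor_comul_apply y
  · apply contract_ext
    intro y
    rw [contract_mul, h, hz, contract_one]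
    exact HopfAlgebra.mul_antipode_rTensor_comul_apply y

theorem comul_inclFst (b : B) : Coalgebra.comul (R := k) (b ⊗ₜ[k] (1 : DualHopf k B)) =
    Algebra.TensorProduct.map (inclFst k B) (inclFst k B) (Coalgebra.comul b) := by
  rw [TensorProduct.comul_tmul, Bialgebra.comul_one]
  generalize Coalgebra.comul (R := k) b = t
  induction t with
  | zero => simp
  | add z₁ z₂ h₁ h₂ => simp only [map_add, add_tmul, h₁, h₂]
  | tmul p q => simp [Algebra.TensorProduct.one_def]

theorem comul_inclSnd (p : DualHopf k B) : Coalgebra.comul (R := k) ((1 : B) ⊗ₜ[k] p) =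
    Algebra.TensorProduct.map (inclSnd k B) (inclSnd k B) (Coalgebra.comul p) := by
  rw [TensorProduct.comul_tmul, Bialgebra.comul_one]
  generalize Coalgebra.comul (R := k) p = t
  induction t with
  | zero => simp
  | add z₁ z₂ h₁ h₂ => simp only [map_add, tmul_add, h₁, h₂]
  | tmul p q => simp [Algebra.TensorProduct.one_def]

/-- By bimultiplicativity both sides of the cocycle identity equal ⟨f₁, a₂⟩ ⟨f₁, a₃⟩ ⟨f₂, a₃⟩, up to
the order of the factors. -/
theorem isTwist_pairingCocycle [Coalgebra.IsCocomm k B] :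
    IsTwist k (DoubleCoord k B) (pairingCocycle k B) where
  isUnit := isUnit_swappedCanonical.map
    (Algebra.TensorProduct.map (inclSnd k B) (inclFst k B))
  cocycle := by
    -- F places tensors in the variables (f₁, f₂, a₃) and G in (f₁, a₂, a₃); `h3` says that they
    -- agree on the common factor ⟨f₁, a₃⟩.
    let F : DualHopf k B ⊗[k] (DualHopf k B ⊗[k] B) →ₐ[k]
        DoubleCoord k B ⊗[k] (DoubleCoord k B ⊗[k] DoubleCoord k B) :=
      Algebra.TensorProduct.map (inclSnd k B)
        (Algebra.TensorProduct.map (inclSnd k B) (inclFst k B))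
    let G : DualHopf k B ⊗[k] (B ⊗[k] B) →ₐ[k]
        DoubleCoord k B ⊗[k] (DoubleCoord k B ⊗[k] DoubleCoord k B) :=
      Algebra.TensorProduct.map (inclSnd k B)
        (Algebra.TensorProduct.map (inclFst k B) (inclFst k B))
    have h1 : ∀ z : DualHopf k B ⊗[k] B, Algebra.TensorProduct.assoc k k k _ _ _
        (Algebra.TensorProduct.map (Bialgebra.comulAlgHom k (DoubleCoord k B)) (AlgHom.id k _)
          (Algebra.TensorProduct.map (inclSnd k B) (inclFst k B) z)) =
        F (Algebra.TensorProduct.assoc k k k _ _ _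
          (Algebra.TensorProduct.map (Bialgebra.comulAlgHom k _) (AlgHom.id k _) z)) := by
      intro z
      induction z with
      | zero => simp
      | add z₁ z₂ h₁ h₂ => simp only [map_add, h₁, h₂]
      | tmul p b =>
        simp only [Algebra.TensorProduct.map_tmul, Algebra.TensorProduct.includeRight_apply,
          Bialgebra.comulAlgHom_apply, comul_inclSnd, AlgHom.id_apply]
        generalize Coalgebra.comul (R := k) p = t
        induction t with
        | zero => simp
        | add z₁ z₂ h₁ h₂ => simp only [map_add, add_tmul, h₁, h₂]
        | tmul p q => simp [F]
    have h2 : ∀ z : DualHopf k B ⊗[k] B,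
        Algebra.TensorProduct.map (AlgHom.id k _) (Bialgebra.comulAlgHom k (DoubleCoord k B))
          (Algebra.TensorProduct.map (inclSnd k B) (inclFst k B) z) =
        G (Algebra.TensorProduct.map (AlgHom.id k _) (Bialgebra.comulAlgHom k _) z) := by
      intro z
      induction z with
      | zero => simp
      | add z₁ z₂ h₁ h₂ => simp only [map_add, h₁, h₂]
      | tmul p b =>
        simp only [Algebra.TensorProduct.map_tmul, Algebra.TensorProduct.includeLeft_apply,
          Bialgebra.comulAlgHom_apply, comul_inclFst, AlgHom.id_apply, G]
    have h3 : ∀ z : DualHopf k B ⊗[k] B,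
        F (Algebra.TensorProduct.map (AlgHom.id k _) Algebra.TensorProduct.includeRight z) =
        G (Algebra.TensorProduct.map (AlgHom.id k _) Algebra.TensorProduct.includeRight z) := by
      intro z
      induction z with
      | zero => simp
      | add z₁ z₂ h₁ h₂ => simp only [map_add, h₁, h₂]
      | tmul p b => simp [F, G]
    have h4 : ∀ z : DualHopf k B ⊗[k] B,
        G (Algebra.TensorProduct.map (AlgHom.id k _) Algebra.TensorProduct.includeLeft z) =
        Algebra.TensorProduct.assoc k k k _ _ _
          ((Algebra.TensorProduct.map (inclSnd k B) (inclFst k B) z) ⊗ₜ 1) := by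
      intro z
      induction z with
      | zero => simp
      | add z₁ z₂ h₁ h₂ => simp only [map_add, add_tmul, h₁, h₂]
      | tmul p b => simp [G, Algebra.TensorProduct.one_def]
    have h5 : F (1 ⊗ₜ swappedCanonical k B) = 1 ⊗ₜ pairingCocycle k B := by
      simp [F, pairingCocycle_eq, Algebra.TensorProduct.one_def]
    have hc : ∀ x y : DoubleCoord k B ⊗[k] (DoubleCoord k B ⊗[k] DoubleCoord k B),
        x * y = y * x :=
      tensor_mul_comm doubleCoord_mul_comm (tensor_mul_comm doubleCoord_mul_comm
        doubleCoord_mul_comm)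
    rw [map_mul, pairingCocycle_eq, h1, h2, swappedCanonical_comul_left,
      swappedCanonical_comul_right, map_mul, map_mul, h3, h4, h5, ← pairingCocycle_eq, hc,
      mul_assoc]
  counit_left := by
    have h : ∀ z : DualHopf k B ⊗[k] B, Algebra.TensorProduct.lid k _
        (Algebra.TensorProduct.map (Bialgebra.counitAlgHom k (DoubleCoord k B)) (AlgHom.id k _)
          (Algebra.TensorProduct.map (inclSnd k B) (inclFst k B) z)) =
        inclFst k B (contract z 1) := by
      intro z
      induction z with
      | zero => simp
      | add z₁ z₂ h₁ h₂ => simp only [map_add, LinearMap.add_apply, h₁, h₂]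
      | tmul p b => simp [TensorProduct.smul_tmul']
    rw [pairingCocycle_eq, h, contract_swappedCanonical, map_one]
  counit_right := by
    have h : ∀ z : DualHopf k B ⊗[k] B, Algebra.TensorProduct.rid k k _
        (Algebra.TensorProduct.map (AlgHom.id k _) (Bialgebra.counitAlgHom k (DoubleCoord k B))
          (Algebra.TensorProduct.map (inclSnd k B) (inclFst k B) z)) =
        inclSnd k B ((toDual k B).symm (Coalgebra.counit ∘ₗ contract z)) := by
      intro z
      induction z with
      | zero => simp
      | add z₁ z₂ h₁ h₂ => simp only [map_add, LinearMap.comp_add, h₁, h₂]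
      | tmul p b =>
        have e : (toDual k B).symm (Coalgebra.counit ∘ₗ contract (p ⊗ₜ[k] b)) =
            Coalgebra.counit (R := k) b • p := by
          apply toDual_ext
          intro y
          simp [mul_comm]
        rw [e]
        simp
    have e : (toDual k B).symm (Coalgebra.counit ∘ₗ contract (swappedCanonical k B)) = 1 := by
      apply toDual_ext
      intro y
      simp [contract_swappedCanonical]
    rw [pairingCocycle_eq, h, e, map_one]

end PairingCocycle

/-! ### The simple comodule over the twisted coalgebra -/

/-- A coaction on `V` obtained by restriction along an embedding of `V` in `C` as a right coideal. -/
@[reducible]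
def FDComod.ofCoideal {k : Type u} {C : Type v} [Field k] [AddCommGroup C] [Module k C]
    (cs : Coalgebra k C) (V : Type u) [AddCommGroup V] [Module k V] [FiniteDimensional k V]
    (j : V →ₗ[k] C) (hj : Function.Injective j) (ρ : V →ₗ[k] V ⊗[k] C)
    (h : j.rTensor C ∘ₗ ρ = cs.comul ∘ₗ j) : FDComod k C cs where
  carrier := V
  coact := ρ
  coassoc := by
    ext v
    -- Over a field j ⊗ id stays injective, so the axiom may be checked in C, where it is
    -- coassociativity of C.
    apply Module.Flat.rTensor_preserves_injective_linearMap (M := C ⊗[k] C) j hj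
    have h' : ∀ v, j.rTensor C (ρ v) = cs.comul (j v) := LinearMap.congr_fun h
    have h1 : ∀ z : V ⊗[k] C, j.rTensor (C ⊗[k] C) (TensorProduct.assoc k V C C (ρ.rTensor C z)) =
        TensorProduct.assoc k C C C (cs.comul.rTensor C (j.rTensor C z)) := by
      intro z
      induction z with
      | zero => simp
      | add x y hx hy => simp only [map_add, hx, hy]
      | tmul x c =>
        simp only [LinearMap.rTensor_tmul]
        rw [← h']
        generalize ρ x = t
        induction t with
        | zero => simp
        | add x y hx hy => simp only [map_add, add_tmul, hx, hy]
        | tmul x c => simp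
    have h2 : ∀ z : V ⊗[k] C, j.rTensor (C ⊗[k] C) (cs.comul.lTensor V z) =
        cs.comul.lTensor C (j.rTensor C z) := by
      intro z
      induction z with
      | zero => simp
      | add x y hx hy => simp only [map_add, hx, hy]
      | tmul x c => simp
    simp only [LinearMap.comp_apply, LinearEquiv.coe_coe]
    rw [h1, h2, h']
    exact LinearMap.congr_fun cs.coassoc (j v)
  counit := by
    ext v
    apply Module.Flat.rTensor_preserves_injective_linearMap (M := k) j hj
    have h2 : ∀ z : V ⊗[k] C, j.rTensor k (cs.counit.lTensor V z) =
        cs.counit.lTensor C (j.rTensor C z) := by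
      intro z
      induction z with
      | zero => simp
      | add x y hx hy => simp only [map_add, hx, hy]
      | tmul x c => simp
    rw [LinearMap.comp_apply, h2]
    refine (congrArg (cs.counit.lTensor C) (LinearMap.congr_fun h v)).trans ?_
    exact LinearMap.congr_fun cs.lTensor_counit_comp_comul (j v)

theorem inclSnd_injective {k B : Type u} [Field k] [CommRing B] [HopfAlgebra k B] : Function.Injective (inclSnd k B) := by
  intro p q h
  have := congrArg (fun z => TensorProduct.lid k _
    ((Coalgebra.counit (R := k) (A := B)).rTensor (DualHopf k B) z)) h
  simpa using this

instance {k : Type u} {B : Type v} [Field k] [Ring B] [HopfAlgebra k B] :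
    Nontrivial (DualHopf k B) := by
  refine ⟨1, 0, fun h => one_ne_zero (α := k) ?_⟩
  have := congrArg (fun ξ => DualHopf.toDual k B ξ 1) h
  simp at this

section Heisenberg

open DualHopf

variable {k : Type u} {B : Type u} [Field k] [CommRing B] [HopfAlgebra k B]
  [FiniteDimensional k B]

variable (k B) in
/-- The coaction `v ↦ ∑ v₁ βᵢ ⊗ (bᵢ ⊗ v₂)` of `𝒪(A × Aᴰ)` on `𝒪(Aᴰ)`; it is the projective
representation of `A × Aᴰ` by multiplications and translations. -/
def heisenbergCoact : DualHopf k B →ₗ[k] DualHopf k B ⊗[k] DoubleCoord k B :=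
  LinearMap.mulRight k
      (Algebra.TensorProduct.map (AlgHom.id k _) (inclFst k B) (swappedCanonical k B)) ∘ₗ
    (Algebra.TensorProduct.map (AlgHom.id k _) (inclSnd k B)).toLinearMap ∘ₗ Coalgebra.comul

theorem heisenbergCoact_apply (v : DualHopf k B) : heisenbergCoact k B v =
    Algebra.TensorProduct.map (AlgHom.id k _) (inclSnd k B) (Coalgebra.comul v) *
    Algebra.TensorProduct.map (AlgHom.id k _) (inclFst k B) (swappedCanonical k B) := rfl

/-- The left legs of ψ and of Δ(1 ⊗ v) both lie in 1 ⊗ B*. Hence 1 ⊗ B* is a right coideal for Δ_ψ,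
and the comodule axioms for the coaction come for free. -/
theorem inclSnd_rTensor_heisenbergCoact (v : DualHopf k B) :
    (inclSnd k B).toLinearMap.rTensor (DoubleCoord k B) (heisenbergCoact k B v) =
      Twist.twistedComul (pairingCocycle k B) (inclSnd k B v) := by
  have h : ∀ z, (inclSnd k B).toLinearMap.rTensor (DoubleCoord k B) z =
      Algebra.TensorProduct.map (inclSnd k B) (AlgHom.id k _) z := fun _ => rfl
  rw [h, heisenbergCoact_apply, map_mul, ← AlgHom.comp_apply, ← AlgHom.comp_apply,
    ← Algebra.TensorProduct.map_comp, ← Algebra.TensorProduct.map_comp, Twist.twistedComul_apply,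
    Algebra.TensorProduct.includeRight_apply, comul_inclSnd]
  rfl

variable [Coalgebra.IsCocomm k B]

variable (k B) in
/-- The comodule over the twisted coalgebra with coaction `heisenbergCoact`. -/
@[reducible]
def heisenbergComod :
    FDComod k (DoubleCoord k B) (Twist.twistedCoalgebra (isTwist_pairingCocycle (k := k) (B := B))) :=
  FDComod.ofCoideal _ (DualHopf k B) (inclSnd k B).toLinearMap inclSnd_injective
    (heisenbergCoact k B) (LinearMap.ext inclSnd_rTensor_heisenbergCoact)

/-- With g(q)(b) = ξ(b ⊗ q), the operator of ξ is the convolution id * g on Hom(B*, B*). -/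
theorem heisenbergComod_dualAct (ξ : Module.Dual k (DoubleCoord k B)) :
    (heisenbergComod k B).dualAct ξ = LinearMap.mul' k _ ∘ₗ
      TensorProduct.map LinearMap.id ((toDual k B).symm.toLinearMap ∘ₗ
        (TensorProduct.mk k B (DualHopf k B)).flip.compr₂ ξ) ∘ₗ Coalgebra.comul := by
  ext v
  rw [FDComod.dualAct_apply]
  change TensorProduct.rid k (DualHopf k B) (ξ.lTensor _ (heisenbergCoact k B v)) = _
  rw [heisenbergCoact_apply, LinearMap.comp_apply, LinearMap.comp_apply]
  generalize Coalgebra.comul (R := k) v = t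
  induction t with
  | zero => simp
  | add x y hx hy => simp only [map_add, add_mul, hx, hy]
  | tmul p q =>
    have h : ∀ z : DualHopf k B ⊗[k] B, TensorProduct.rid k (DualHopf k B) (ξ.lTensor _
        ((p ⊗ₜ[k] inclSnd k B q) * Algebra.TensorProduct.map (AlgHom.id k _) (inclFst k B) z)) =
        p * (toDual k B).symm ((TensorProduct.mk k B (DualHopf k B)).flip.compr₂ ξ q ∘ₗ
          contract z) := by
      intro z
      induction z with
      | zero => simp
      | add x y hx hy => simp only [map_add, mul_add, LinearMap.comp_add, hx, hy]
      | tmul β b =>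
        have e : (toDual k B).symm ((TensorProduct.mk k B (DualHopf k B)).flip.compr₂ ξ q ∘ₗ
            contract (β ⊗ₜ[k] b)) = ξ (b ⊗ₜ q) • β := by
          apply toDual_ext
          intro y
          simp [mul_comm]
        rw [e]
        simp
    refine (h _).trans ?_
    rw [show contract (swappedCanonical k B) = LinearMap.id from
      LinearMap.ext contract_swappedCanonical]
    rfl

/-- Convolving id * g = 0 on the left with the antipode of B* gives g = 0, hence ξ = 0. Surjectivity
follows because K* and End(B*) both have dimension (dim B)². -/
theorem heisenbergComod_dualAct_bijective :
    Function.Bijective (heisenbergComod k B).dualAct := by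
  have hinj : Function.Injective (heisenbergComod k B).dualAct := by
    rw [← LinearMap.ker_eq_bot, LinearMap.ker_eq_bot']
    intro ξ h
    rw [heisenbergComod_dualAct] at h
    set g : DualHopf k B →ₗ[k] DualHopf k B := (toDual k B).symm.toLinearMap ∘ₗ
        (TensorProduct.mk k B (DualHopf k B)).flip.compr₂ ξ with hg
    have h' : WithConv.toConv LinearMap.id * WithConv.toConv g = 0 := congrArg WithConv.toConv h
    have hg0 : WithConv.toConv g = 0 := by
      rw [← one_mul (WithConv.toConv g), ← LinearMap.antipode_mul_id, mul_assoc, h', mul_zero]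
    have hg0' : g = 0 := congrArg WithConv.ofConv hg0
    apply TensorProduct.ext'
    intro b p
    have := congrArg (fun f => toDual k B (f p) b) hg0'
    simpa [hg] using this
  refine ⟨hinj, ?_⟩
  have hd : Module.finrank k (DualHopf k B) = Module.finrank k B :=
    (toDual k B).finrank_eq.trans Subspace.dual_finrank_eq
  refine (LinearMap.injective_iff_surjective_of_finrank_eq_finrank ?_).1 hinj
  rw [Subspace.dual_finrank_eq, Module.finrank_tensorProduct]
  refine (congrArg₂ _ hd.symm rfl).trans ?_
  exact (Module.finrank_linearMap k k (DualHopf k B) (DualHopf k B)).symm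

end Heisenberg

/-! ### The operators intertwining the trivial and the tensor product coaction -/

section Intertwining

open DualHopf

variable {k : Type u} {B : Type u} [Field k] [CommRing B] [HopfAlgebra k B]
  [FiniteDimensional k B]

/-- The coaction is a product of Δ(v), which contracts to y ↦ y ▷ v, and the canonical element,
which contracts to y ↦ y; their convolution is y ↦ y₂ ⊗ (y₁ ▷ v). -/
theorem contract_heisenbergCoact (v : DualHopf k B) (y : B) :
    contract (heisenbergCoact k B v) y = TensorProduct.map LinearMap.id (hit.flip v)
      (TensorProduct.comm k B B (Coalgebra.comul y)) := by
  rw [heisenbergCoact_apply, contract_mul]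
  generalize Coalgebra.comul (R := k) y = t
  induction t with
  | zero => simp
  | add z₁ z₂ h₁ h₂ => simp only [map_add, h₁, h₂]
  | tmul a b =>
    rw [TensorProduct.map_tmul, contract_map, contract_map, contract_comul,
      contract_swappedCanonical]
    simp

theorem heisenbergCoact_mul (q v : DualHopf k B) : heisenbergCoact k B (q * v) =
    Algebra.TensorProduct.map (AlgHom.id k _) (inclSnd k B) (Coalgebra.comul q) *
      heisenbergCoact k B v := by
  rw [heisenbergCoact_apply, heisenbergCoact_apply, Bialgebra.comul_mul, map_mul, mul_assoc]

/-- `∑ (1 ⊗ p₁) ρ(S(p₂) v) = (S(p) ⊗ 1) ρ(v)`. -/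
theorem mulLeft_rTensor_heisenbergCoact (p v : DualHopf k B) :
    (LinearMap.mulLeft k (HopfAlgebra.antipode k p)).rTensor (DoubleCoord k B)
        (heisenbergCoact k B v) =
      LinearMap.mul' k _ (TensorProduct.map
        ((Algebra.TensorProduct.includeRight :
          DoubleCoord k B →ₐ[k] DualHopf k B ⊗[k] DoubleCoord k B).comp (inclSnd k B)).toLinearMap
        (heisenbergCoact k B ∘ₗ LinearMap.mulRight k v ∘ₗ HopfAlgebra.antipode k)
        (Coalgebra.comul p)) := by
  have h1 : ∀ t : DualHopf k B ⊗[k] DualHopf k B, LinearMap.mul' k _ (TensorProduct.map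
        ((Algebra.TensorProduct.includeRight :
          DoubleCoord k B →ₐ[k] DualHopf k B ⊗[k] DoubleCoord k B).comp (inclSnd k B)).toLinearMap
        (heisenbergCoact k B ∘ₗ LinearMap.mulRight k v ∘ₗ HopfAlgebra.antipode k) t) =
      Algebra.TensorProduct.map (AlgHom.id k _) (inclSnd k B) (LinearMap.mul' k _
        (TensorProduct.map (Algebra.TensorProduct.includeRight :
          DualHopf k B →ₐ[k] DualHopf k B ⊗[k] DualHopf k B).toLinearMap
        (Coalgebra.comul ∘ₗ HopfAlgebra.antipode k) t)) * heisenbergCoact k B v := by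
    intro t
    induction t with
    | zero => simp
    | add z₁ z₂ h₁ h₂ => simp only [map_add, add_mul, h₁, h₂]
    | tmul p q => simp [heisenbergCoact_mul, mul_assoc]
  have h2 : ∀ (q : DualHopf k B) (z : DualHopf k B ⊗[k] DoubleCoord k B),
      (LinearMap.mulLeft k q).rTensor (DoubleCoord k B) z = (q ⊗ₜ 1) * z := by
    intro q z
    induction z with
    | zero => simp
    | add z₁ z₂ h₁ h₂ => simp only [map_add, mul_add, h₁, h₂]
    | tmul p q => simp
  rw [h1, one_tmul_mul_comul_antipode, h2]
  simp [Algebra.TensorProduct.one_def]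

/-- `∑ (1 ⊗ b₁) ρ(b₂ ▷ v) = (b ▷ v₀) ⊗ v₁`. -/
theorem hit_rTensor_heisenbergCoact [Coalgebra.IsCocomm k B] (b : B) (v : DualHopf k B) :
    (hit b).rTensor (DoubleCoord k B) (heisenbergCoact k B v) =
      LinearMap.mul' k _ (TensorProduct.map
        ((Algebra.TensorProduct.includeRight :
          DoubleCoord k B →ₐ[k] DualHopf k B ⊗[k] DoubleCoord k B).comp (inclFst k B)).toLinearMap
        (heisenbergCoact k B ∘ₗ hit.flip v) (Coalgebra.comul b)) := by
  apply contract_ext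
  intro y
  rw [contract_rTensor_hit, contract_heisenbergCoact, Bialgebra.comul_mul]
  -- The left side has b₂ in the coefficient and b₁ in the action on v, the right side the opposite;
  -- cocommutativity reconciles them.
  conv_rhs => rw [← Coalgebra.comm_comul k b]
  generalize Coalgebra.comul (R := k) b = s
  induction s with
  | zero => simp
  | add z₁ z₂ h₁ h₂ => simp only [map_add, add_mul, LinearMap.add_apply, h₁, h₂]
  | tmul b b' =>
    simp only [TensorProduct.comm_tmul, TensorProduct.map_tmul, LinearMap.mul'_apply,
      AlgHom.toLinearMap_apply, AlgHom.comp_apply, Algebra.TensorProduct.includeLeft_apply,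
      Algebra.TensorProduct.includeRight_apply, LinearMap.comp_apply, LinearMap.flip_apply,
      contract_one_tmul_mul, contract_heisenbergCoact]
    generalize Coalgebra.comul (R := k) y = t
    induction t with
    | zero => simp
    | add z₁ z₂ h₁ h₂ => simp only [map_add, mul_add, h₁, h₂]
    | tmul y y' =>
      simp only [Algebra.TensorProduct.tmul_mul_tmul, TensorProduct.comm_tmul,
        TensorProduct.map_tmul, LinearMap.flip_apply, LinearMap.id_apply, one_mul, hit_mul,
        commute_hit b y, Module.End.mul_apply]

/-- The condition `T(x) v₀ ⊗ v₁ = ∑ (1 ⊗ x₁) ρ(T(x₂) v)` on a coaction `ρ(v) = v₀ ⊗ v₁` on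
`𝒪(Aᴰ)`, for the operators `T = hitAntipode`. -/
def Intertwines (ρ : DualHopf k B →ₗ[k] DualHopf k B ⊗[k] DoubleCoord k B) : Prop :=
  ∀ x v, (hitAntipode x).rTensor (DoubleCoord k B) (ρ v) =
    LinearMap.mul' k _ (TensorProduct.map
      (Algebra.TensorProduct.includeRight :
        DoubleCoord k B →ₐ[k] DualHopf k B ⊗[k] DoubleCoord k B).toLinearMap
      (ρ ∘ₗ hitAntipode.flip v) (Coalgebra.comul x))

/-- T(b ⊗ p) is a multiplication followed by a translation, each with its own intertwining identity.
They combine because the coefficient 1 ⊗ z produced by the first is untouched by the second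
operator. -/
theorem intertwines_heisenbergCoact [Coalgebra.IsCocomm k B] :
    Intertwines (heisenbergCoact k B) := by
  intro x v
  have hr : ∀ (b : B) (z : DoubleCoord k B) (w : DualHopf k B ⊗[k] DoubleCoord k B),
      (hit b).rTensor (DoubleCoord k B) ((1 ⊗ₜ z) * w) =
      (1 ⊗ₜ z) * (hit b).rTensor (DoubleCoord k B) w := by
    intro b z w
    induction w with
    | zero => simp
    | add z₁ z₂ h₁ h₂ => simp only [map_add, mul_add, h₁, h₂]
    | tmul p q => simp
  induction x with
  | zero => simp
  | add x y hx hy => simp only [map_add, LinearMap.rTensor_add, LinearMap.add_apply, hx, hy]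
  | tmul b p =>
    have h1 : hitAntipode (b ⊗ₜ[k] p) =
        hit b ∘ₗ LinearMap.mulLeft k (HopfAlgebra.antipode k p) := by
      ext v
      simp
    rw [h1, LinearMap.rTensor_comp, LinearMap.comp_apply, mulLeft_rTensor_heisenbergCoact,
      TensorProduct.comul_tmul]
    generalize Coalgebra.comul (R := k) p = t
    induction t with
    | zero => simp
    | add z₁ z₂ h₁ h₂ => simp only [map_add, tmul_add, h₁, h₂]
    | tmul p q =>
      simp only [TensorProduct.map_tmul, LinearMap.mul'_apply, AlgHom.toLinearMap_apply,
        AlgHom.comp_apply, Algebra.TensorProduct.includeRight_apply, hr, LinearMap.comp_apply,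
        hit_rTensor_heisenbergCoact, LinearMap.mulRight_apply]
      generalize Coalgebra.comul (R := k) b = s
      induction s with
      | zero => simp
      | add z₁ z₂ h₁ h₂ => simp only [map_add, mul_add, add_tmul, h₁, h₂]
      | tmul a b => simp [← mul_assoc]

/-- Right multiplication of coefficients commutes with the left multiplication by x₁. This lets the
same T serve every cocycle in the class of ψ. -/
theorem Intertwines.mulRight {ρ : DualHopf k B →ₗ[k] DualHopf k B ⊗[k] DoubleCoord k B}
    (h : Intertwines ρ) (u : DoubleCoord k B) :
    Intertwines ((LinearMap.mulRight k u).lTensor (DualHopf k B) ∘ₗ ρ) := by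
  intro x v
  have h1 : ∀ z : DualHopf k B ⊗[k] DoubleCoord k B,
      (hitAntipode x).rTensor (DoubleCoord k B) ((LinearMap.mulRight k u).lTensor _ z) =
      (LinearMap.mulRight k u).lTensor _ ((hitAntipode x).rTensor (DoubleCoord k B) z) := by
    intro z
    induction z with
    | zero => simp
    | add z₁ z₂ h₁ h₂ => simp only [map_add, h₁, h₂]
    | tmul a b => simp
  have h2 : ∀ (y : DoubleCoord k B) (z : DualHopf k B ⊗[k] DoubleCoord k B),
      (LinearMap.mulRight k u).lTensor _ ((1 ⊗ₜ y) * z) =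
      (1 ⊗ₜ y) * (LinearMap.mulRight k u).lTensor _ z := by
    intro y z
    induction z with
    | zero => simp
    | add z₁ z₂ h₁ h₂ => simp only [map_add, mul_add, h₁, h₂]
    | tmul a b => simp [mul_assoc]
  rw [LinearMap.comp_apply, h1, h]
  generalize Coalgebra.comul (R := k) x = t
  induction t with
  | zero => simp
  | add z₁ z₂ h₁ h₂ => simp only [map_add, h₁, h₂]
  | tmul a b => simp [h2]

/-- `∑ T(x₁) T'(x₂) = ε(x)` for `T = hitAntipode` and `T'(b ⊗ p) = (p ·) ∘ (S(b) ▷ ·)`. -/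
theorem exists_convInverse_hitAntipode :
    ∃ T' : DoubleCoord k B →ₗ[k] Module.End k (DualHopf k B), ∀ x,
      LinearMap.mul' k _ (TensorProduct.map hitAntipode T' (Coalgebra.comul x)) =
        algebraMap k (Module.End k (DualHopf k B)) (Coalgebra.counit x) := by
  refine ⟨LinearMap.mul' k _ ∘ₗ TensorProduct.map (LinearMap.mul k _)
    (hit ∘ₗ HopfAlgebra.antipode k) ∘ₗ (TensorProduct.comm k B (DualHopf k B)).toLinearMap, ?_⟩
  intro x
  induction x with
  | zero => simp
  | add x y hx hy => simp only [map_add, hx, hy]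
  | tmul b p =>
    ext v
    have h : ∀ (s : B ⊗[k] B) (t : DualHopf k B ⊗[k] DualHopf k B),
        LinearMap.mul' k _ (TensorProduct.map hitAntipode
          (LinearMap.mul' k _ ∘ₗ TensorProduct.map (LinearMap.mul k _)
            (hit ∘ₗ HopfAlgebra.antipode k) ∘ₗ
              (TensorProduct.comm k B (DualHopf k B)).toLinearMap)
          (TensorProduct.tensorTensorTensorComm k _ _ _ _ (s ⊗ₜ t))) =
        LinearMap.mul' k _ (TensorProduct.map hit (LinearMap.mulLeft k
            (LinearMap.mul k _ (LinearMap.mul' k _ ((HopfAlgebra.antipode k).rTensor _ t))) ∘ₗ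
          hit ∘ₗ HopfAlgebra.antipode k) s) := by
      intro s t
      induction s with
      | zero => simp
      | add z₁ z₂ h₁ h₂ => simp only [map_add, add_tmul, h₁, h₂]
      | tmul a b =>
        induction t with
        | zero => simp [tmul_zero]
        | add z₁ z₂ h₁ h₂ =>
          simp only [map_add, tmul_add, h₁, h₂, TensorProduct.map_tmul, LinearMap.mul'_apply,
            LinearMap.comp_apply, LinearMap.mulLeft_apply, add_mul]
        | tmul p q =>
          ext v
          simp [mul_assoc]
    rw [TensorProduct.comul_tmul]
    refine (LinearMap.congr_fun (h _ _) v).trans ?_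
    -- The middle product S(p₁) p₂ collapses to ε(p) first; only then do b₁ and S(b₂) become
    -- adjacent.
    rw [HopfAlgebra.mul_antipode_rTensor_comul_apply]
    have h2 : ∀ s : B ⊗[k] B, LinearMap.mul' k _ (TensorProduct.map hit (LinearMap.mulLeft k
            (LinearMap.mul k _ (algebraMap k (DualHopf k B) (Coalgebra.counit p))) ∘ₗ
          hit ∘ₗ HopfAlgebra.antipode k) s) = (Coalgebra.counit (R := k) p) •
        hit (k := k) (LinearMap.mul' k _ ((HopfAlgebra.antipode k).lTensor _ s)) := by
      intro s
      induction s with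
      | zero => simp
      | add z₁ z₂ h₁ h₂ => simp only [map_add, smul_add, h₁, h₂]
      | tmul a b =>
        ext v
        simp [hit_mul, Algebra.algebraMap_eq_smul_one]
    rw [h2, HopfAlgebra.mul_antipode_lTensor_comul_apply, Algebra.algebraMap_eq_smul_one, map_smul,
      hit_one, Algebra.algebraMap_eq_smul_one]
    simp [mul_smul]

end Intertwining

/-! ### Self-duality of `𝒪(A × Aᴰ)` -/

theorem IsTwist.map {k : Type u} {K : Type v} {K' : Type w} [Field k] [Ring K] [HopfAlgebra k K]
    [Ring K'] [HopfAlgebra k K'] {ψ : K ⊗[k] K} (hψ : IsTwist k K ψ) (f : K →ₐ[k] K')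
    (hf : ∀ a, Coalgebra.comul (f a) = Algebra.TensorProduct.map f f (Coalgebra.comul (R := k) a))
    (hf' : ∀ a, Coalgebra.counit (f a) = Coalgebra.counit (R := k) a) :
    IsTwist k K' (Algebra.TensorProduct.map f f ψ) where
  isUnit := hψ.isUnit.map _
  cocycle := by
    let F := Algebra.TensorProduct.map f (Algebra.TensorProduct.map f f)
    have h1 : ∀ z, Algebra.TensorProduct.assoc k k k K' K' K'
        (Algebra.TensorProduct.map (Bialgebra.comulAlgHom k K') (AlgHom.id k K')
          (Algebra.TensorProduct.map f f z)) =
        F (Algebra.TensorProduct.assoc k k k K K K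
          (Algebra.TensorProduct.map (Bialgebra.comulAlgHom k K) (AlgHom.id k K) z)) := by
      intro z
      induction z with
      | zero => simp
      | add x y hx hy => simp only [map_add, hx, hy]
      | tmul x y =>
        simp only [Algebra.TensorProduct.map_tmul, Bialgebra.comulAlgHom_apply, AlgHom.id_apply, hf]
        generalize Coalgebra.comul (R := k) x = t
        induction t with
        | zero => simp
        | add x y hx hy => simp only [map_add, add_tmul, hx, hy]
        | tmul x y => simp [F]
    have h2 : ∀ z, Algebra.TensorProduct.map (AlgHom.id k K') (Bialgebra.comulAlgHom k K')
          (Algebra.TensorProduct.map f f z) =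
        F (Algebra.TensorProduct.map (AlgHom.id k K) (Bialgebra.comulAlgHom k K) z) := by
      intro z
      induction z with
      | zero => simp
      | add x y hx hy => simp only [map_add, hx, hy]
      | tmul x y =>
        simp only [Algebra.TensorProduct.map_tmul, Bialgebra.comulAlgHom_apply, AlgHom.id_apply,
          hf, F]
    have h3 : ∀ z, Algebra.TensorProduct.assoc k k k K' K' K'
        ((Algebra.TensorProduct.map f f z) ⊗ₜ 1) =
        F (Algebra.TensorProduct.assoc k k k K K K (z ⊗ₜ 1)) := by
      intro z
      induction z with
      | zero => simp
      | add x y hx hy => simp only [map_add, add_tmul, hx, hy]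
      | tmul x y => simp [F]
    have h4 : ∀ z, 1 ⊗ₜ (Algebra.TensorProduct.map f f z) = F (1 ⊗ₜ z) := by
      intro z
      simp [F]
    rw [map_mul, h1, h2, h3, h4, ← map_mul, ← map_mul, ← map_mul, hψ.cocycle]
  counit_left := by
    have h : ∀ z, Algebra.TensorProduct.lid k K'
        (Algebra.TensorProduct.map (Bialgebra.counitAlgHom k K') (AlgHom.id k K')
          (Algebra.TensorProduct.map f f z)) = f (Algebra.TensorProduct.lid k K
        (Algebra.TensorProduct.map (Bialgebra.counitAlgHom k K) (AlgHom.id k K) z)) := by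
      intro z
      induction z with
      | zero => simp
      | add x y hx hy => simp only [map_add, hx, hy]
      | tmul x y => simp [hf']
    rw [h, hψ.counit_left, map_one]
  counit_right := by
    have h : ∀ z, Algebra.TensorProduct.rid k k K'
        (Algebra.TensorProduct.map (AlgHom.id k K') (Bialgebra.counitAlgHom k K')
          (Algebra.TensorProduct.map f f z)) = f (Algebra.TensorProduct.rid k k K
        (Algebra.TensorProduct.map (AlgHom.id k K) (Bialgebra.counitAlgHom k K) z)) := by
      intro z
      induction z with
      | zero => simp
      | add x y hx hy => simp only [map_add, hx, hy]
      | tmul x y => simp [hf']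
    rw [h, hψ.counit_right, map_one]

section SelfDual

open DualHopf

variable {k : Type u} {B : Type u} [Field k] [CommRing B] [HopfAlgebra k B]
  [FiniteDimensional k B]

variable (k B) in
/-- The identification of `𝒪(A × Aᴰ)` with its dual given by the symmetric form
`(b ⊗ p, b' ⊗ p') ↦ p(b') p'(b)`. -/
def selfDual : DoubleCoord k B ≃ₗ[k] DualHopf k (DoubleCoord k B) :=
  TensorProduct.comm k B (DualHopf k B) ≪≫ₗ
    TensorProduct.congr (toDual k B) (Module.evalEquiv k B ≪≫ₗ (toDual k B).dualMap) ≪≫ₗ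
      TensorProduct.dualDistribEquiv k B (DualHopf k B) ≪≫ₗ (toDual k (DoubleCoord k B)).symm

@[simp]
theorem toDual_selfDual_tmul (b b' : B) (p p' : DualHopf k B) :
    toDual k (DoubleCoord k B) (selfDual k B (b ⊗ₜ p)) (b' ⊗ₜ p') =
      toDual k B p b' * toDual k B p' b := by
  simp only [selfDual, LinearEquiv.trans_apply, LinearEquiv.apply_symm_apply]
  exact TensorProduct.dualDistrib_apply _ _ _ _

theorem selfDual_symmetric (x y : DoubleCoord k B) :
    toDual k (DoubleCoord k B) (selfDual k B x) y = toDual k (DoubleCoord k B) (selfDual k B y) x := by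
  induction x using TensorProduct.induction_on with
  | zero => simp
  | add x₁ x₂ h₁ h₂ => simp only [map_add, LinearMap.add_apply, h₁, h₂]
  | tmul b p =>
    induction y using TensorProduct.induction_on with
    | zero => simp
    | add x₁ x₂ h₁ h₂ => simp only [map_add, LinearMap.add_apply, h₁, h₂]
    | tmul b' p' => simp [mul_comm]

theorem selfDual_one : selfDual k B 1 = 1 := by
  apply (toDual k (DoubleCoord k B)).injective
  apply TensorProduct.ext'
  intro b p
  rw [Algebra.TensorProduct.one_def, toDual_selfDual_tmul, toDual_one, toDual_one,
    TensorProduct.counit_tmul]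
  simp [mul_comm]

/-- The form exchanges the two tensor factors, pairing the product of B with the coproduct of B* and
the product of B* with the coproduct of B. -/
theorem selfDual_mul (x y : DoubleCoord k B) :
    selfDual k B (x * y) = selfDual k B x * selfDual k B y := by
  induction x using TensorProduct.induction_on with
  | zero => simp
  | add x₁ x₂ h₁ h₂ => simp only [map_add, add_mul, h₁, h₂]
  | tmul b p =>
    induction y using TensorProduct.induction_on with
    | zero => simp
    | add x₁ x₂ h₁ h₂ => simp only [map_add, mul_add, h₁, h₂]
    | tmul b' p' =>
      apply (toDual k (DoubleCoord k B)).injective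
      apply TensorProduct.ext'
      intro c q
      rw [Algebra.TensorProduct.tmul_mul_tmul, toDual_selfDual_tmul, toDual_mul_apply,
        toDual_mul_apply, ← pair_comul, TensorProduct.comul_tmul]
      generalize Coalgebra.comul (R := k) c = s
      induction s with
      | zero => simp
      | add z₁ z₂ h₁ h₂ => simp only [map_add, add_tmul, add_mul, h₁, h₂]
      | tmul c c' =>
        generalize Coalgebra.comul (R := k) q = t
        induction t with
        | zero => simp
        | add z₁ z₂ h₁ h₂ =>
          simp only [map_add, tmul_add, LinearMap.add_apply, mul_add, h₁, h₂]
        | tmul q q' =>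
          simp
          ring

variable (k B) in
/-- `selfDual` as an algebra homomorphism. -/
def selfDualAlgHom : DoubleCoord k B →ₐ[k] DualHopf k (DoubleCoord k B) :=
  AlgHom.ofLinearMap (selfDual k B).toLinearMap selfDual_one selfDual_mul

/-- The form is symmetric, so compatibility with coproducts is the transpose of multiplicativity. -/
theorem comul_selfDual (x : DoubleCoord k B) : Coalgebra.comul (selfDualAlgHom k B x) =
    Algebra.TensorProduct.map (selfDualAlgHom k B) (selfDualAlgHom k B)
      (Coalgebra.comul (R := k) x) := by
  apply pair_injective
  apply TensorProduct.ext'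
  intro a b
  refine (pair_comul k _ (selfDual k B x) a b).trans ?_
  rw [selfDual_symmetric, selfDual_mul, toDual_mul_apply]
  generalize Coalgebra.comul (R := k) x = t
  induction t with
  | zero => simp
  | add z₁ z₂ h₁ h₂ => simp only [map_add, LinearMap.add_apply, h₁, h₂]
  | tmul x y =>
    change _ = pair k _ (selfDual k B x ⊗ₜ selfDual k B y) _
    rw [pair_tmul, selfDual_symmetric x, selfDual_symmetric y]
    simp

theorem counit_selfDual (x : DoubleCoord k B) :
    Coalgebra.counit (selfDualAlgHom k B x) = Coalgebra.counit (R := k) x := by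
  change toDual k _ (selfDual k B x) 1 = _
  rw [selfDual_symmetric, selfDual_one, toDual_one]

variable (k B) in
/-- The twist of `k[A × Aᴰ]` which corresponds to the pairing cocycle under self-duality. -/
def dualTwist : DualHopf k (DoubleCoord k B) ⊗[k] DualHopf k (DoubleCoord k B) :=
  Algebra.TensorProduct.map (selfDualAlgHom k B) (selfDualAlgHom k B) (pairingCocycle k B)

/-- J as a bilinear form on K. The legs of ψ are 1 ⊗ βᵢ and bᵢ ⊗ 1, so p and b' meet only units, and
the canonical element evaluates p' at b. -/
theorem pair_dualTwist_tmul (b b' : B) (p p' : DualHopf k B) :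
    pair k _ (dualTwist k B) ((b ⊗ₜ p) ⊗ₜ (b' ⊗ₜ p')) =
      Coalgebra.counit (R := k) p * Coalgebra.counit (R := k) b' * toDual k B p' b := by
  have h : ∀ z : DualHopf k B ⊗[k] B, pair k (DoubleCoord k B)
      (Algebra.TensorProduct.map (selfDualAlgHom k B) (selfDualAlgHom k B)
        (Algebra.TensorProduct.map (inclSnd k B) (inclFst k B) z)) ((b ⊗ₜ p) ⊗ₜ (b' ⊗ₜ p')) =
      Coalgebra.counit (R := k) p * Coalgebra.counit (R := k) b' * toDual k B p' (contract z b) := by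
    intro z
    induction z with
    | zero => simp
    | add z₁ z₂ h₁ h₂ => simp only [map_add, LinearMap.add_apply, mul_add, h₁, h₂]
    | tmul β c =>
      change pair k _ (selfDual k B (1 ⊗ₜ β) ⊗ₜ selfDual k B (c ⊗ₜ 1)) _ = _
      rw [pair_tmul, toDual_selfDual_tmul, toDual_selfDual_tmul, contract_tmul, map_smul,
        toDual_one, smul_eq_mul]
      change _ = toDual k B p 1 * _ * _
      ring
  rw [dualTwist, pairingCocycle_eq, h, contract_swappedCanonical]

variable [Coalgebra.IsCocomm k B]

theorem isTwist_dualTwist : IsTwist k (DualHopf k (DoubleCoord k B)) (dualTwist k B) :=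
  isTwist_pairingCocycle.map _ comul_selfDual counit_selfDual

/-- Self-duality is an isomorphism of twisted coalgebras from K_ψ to (K*)_J, so the Heisenberg
comodule can be pushed along it. -/
theorem isNondegenerate_dualTwist :
    IsNondegenerate (isTwist_dualTwist (k := k) (B := B)) := by
  let V := FDComod.push (cs := Twist.twistedCoalgebra (isTwist_pairingCocycle (k := k) (B := B)))
    (ds := Twist.twistedCoalgebra (isTwist_dualTwist (k := k) (B := B)))
    (selfDual k B).toLinearMap
    (LinearMap.ext fun x =>
      (congrArg (· * dualTwist k B) (comul_selfDual x)).trans (map_mul (Algebra.TensorProduct.map (selfDualAlgHom k B) (selfDualAlgHom k B))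
        (Coalgebra.comul x) (pairingCocycle k B)).symm)
    (LinearMap.ext counit_selfDual) (heisenbergComod k B)
  have : Nontrivial V := inferInstanceAs (Nontrivial (DualHopf k B))
  exact isNondegenerate_of_bijective _ V (FDComod.push_dualAct_bijective _ _ _ _
    (selfDual k B).bijective heisenbergComod_dualAct_bijective)

/-- `∑ T(x₁ y₁) J(x₂, y₂) = T(y) T(x)` for `T = hitAntipode` and `J = dualTwist`. -/
theorem hitAntipode_mul_conv_dualTwist (x y : DoubleCoord k B) :
    TensorProduct.rid k _ (TensorProduct.map (hitAntipode ∘ₗ LinearMap.mul' k _)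
      (pair k _ (dualTwist k B)) (Coalgebra.comul (R := k) (x ⊗ₜ[k] y))) =
    hitAntipode y * hitAntipode x := by
  let K := DoubleCoord k B
  let E := Module.End k (DualHopf k B)
  obtain ⟨Ω, hΩ⟩ : ∃ Ω : K ⊗[k] K →ₗ[k] K ⊗[k] K →ₗ[k] E, ∀ w w', Ω w w' =
      TensorProduct.rid k E (TensorProduct.map (hitAntipode ∘ₗ LinearMap.mul' k K)
        (pair k K (dualTwist k B)) (TensorProduct.tensorTensorTensorComm k K K K K (w ⊗ₜ w'))) :=
    ⟨(TensorProduct.mk k (K ⊗[k] K) (K ⊗[k] K)).compr₂ ((TensorProduct.rid k E).toLinearMap ∘ₗ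
      TensorProduct.map (hitAntipode ∘ₗ LinearMap.mul' k K) (pair k K (dualTwist k B)) ∘ₗ
        (TensorProduct.tensorTensorTensorComm k K K K K).toLinearMap), fun _ _ => rfl⟩
  obtain ⟨Q, hQ⟩ : ∃ Q : K ⊗[k] K →ₗ[k] E, ∀ w, Q w =
      TensorProduct.rid k E (TensorProduct.map hitAntipode eval w) :=
    ⟨(TensorProduct.rid k E).toLinearMap ∘ₗ TensorProduct.map hitAntipode eval, fun _ => rfl⟩
  obtain ⟨θ, hθ⟩ : ∃ θ : B ⊗[k] B →ₗ[k] DualHopf k B ⊗[k] DualHopf k B →ₗ[k] K ⊗[k] K,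
      ∀ s t, θ s t = TensorProduct.tensorTensorTensorComm k _ _ _ _ (s ⊗ₜ t) :=
    ⟨(TensorProduct.mk k _ _).compr₂
      (TensorProduct.tensorTensorTensorComm k _ _ _ _).toLinearMap, fun _ _ => rfl⟩
  have hθ' : ∀ a a' p p', θ (a ⊗ₜ a') (p ⊗ₜ p') = (a ⊗ₜ p) ⊗ₜ (a' ⊗ₜ p') := fun _ _ _ _ => hθ _ _
  have hΔ : ∀ (b : B) (p : DualHopf k B), Coalgebra.comul (R := k) (b ⊗ₜ[k] p) =
      θ (Coalgebra.comul b) (Coalgebra.comul p) := fun b p => (hθ _ _).symm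
  -- The counits in J absorb the coproducts of p and b'. Those of b and p' survive, gathered in `Q`,
  -- which `hitAntipode_conv_eval` evaluates.
  have h : ∀ (s s' : B ⊗[k] B) (t t' : DualHopf k B ⊗[k] DualHopf k B),
      Ω (θ s t) (θ s' t') = hit (TensorProduct.rid k B (Coalgebra.counit.lTensor B s')) *
        Q (θ s t') * LinearMap.mul k _ (HopfAlgebra.antipode k
          (TensorProduct.rid k _ (Coalgebra.counit.lTensor (DualHopf k B) t))) := by
    intro s s' t t'
    induction s with
    | zero => simp
    | add z₁ z₂ h₁ h₂ => simp only [map_add, LinearMap.add_apply, mul_add, add_mul, h₁, h₂]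
    | tmul a₁ a₂ =>
    induction s' with
    | zero => simp
    | add z₁ z₂ h₁ h₂ => simp only [map_add, LinearMap.add_apply, add_mul, h₁, h₂]
    | tmul b₁ b₂ =>
    induction t with
    | zero => simp
    | add z₁ z₂ h₁ h₂ => simp only [map_add, LinearMap.add_apply, mul_add, h₁, h₂]
    | tmul p₁ p₂ =>
    induction t' with
    | zero => simp
    | add z₁ z₂ h₁ h₂ => simp only [map_add, mul_add, add_mul, h₁, h₂]
    | tmul q₁ q₂ =>
      have e1 : Ω (θ (a₁ ⊗ₜ a₂) (p₁ ⊗ₜ p₂)) (θ (b₁ ⊗ₜ b₂) (q₁ ⊗ₜ q₂)) =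
          (Coalgebra.counit (R := k) p₂ * Coalgebra.counit (R := k) b₂ * toDual k B q₂ a₂) •
            hitAntipode ((a₁ * b₁) ⊗ₜ (p₁ * q₁)) := by
        rw [hΩ, hθ', hθ', TensorProduct.tensorTensorTensorComm_tmul, TensorProduct.map_tmul,
          pair_dualTwist_tmul, TensorProduct.rid_tmul, LinearMap.comp_apply,
          LinearMap.mul'_apply, Algebra.TensorProduct.tmul_mul_tmul]
      have e2 : Q (θ (a₁ ⊗ₜ a₂) (q₁ ⊗ₜ q₂)) = toDual k B q₂ a₂ • hitAntipode (a₁ ⊗ₜ q₁) := by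
        rw [hQ, hθ', TensorProduct.map_tmul, eval_tmul, TensorProduct.rid_tmul]
      rw [e1, e2, LinearMap.lTensor_tmul, LinearMap.lTensor_tmul, TensorProduct.rid_tmul,
        TensorProduct.rid_tmul]
      apply LinearMap.ext
      intro v
      simp only [LinearMap.smul_apply, hitAntipode_tmul, map_smul, Module.End.mul_apply,
        LinearMap.mul_apply', HopfAlgebra.antipode_mul_antidistrib, mul_assoc, hit_mul,
        commute_hit a₁ b₁, smul_smul]
      congr 1
      ring
  induction x using TensorProduct.induction_on with
  | zero => simp
  | add x₁ x₂ h₁ h₂ => simp only [map_add, add_tmul, mul_add, h₁, h₂]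
  | tmul b p =>
    induction y using TensorProduct.induction_on with
    | zero => simp
    | add x₁ x₂ h₁ h₂ => simp only [map_add, tmul_add, add_mul, h₁, h₂]
    | tmul b' p' =>
      have e : TensorProduct.rid k E (TensorProduct.map (hitAntipode ∘ₗ LinearMap.mul' k K)
          (pair k K (dualTwist k B)) (Coalgebra.comul (R := k) ((b ⊗ₜ[k] p) ⊗ₜ[k] (b' ⊗ₜ[k] p')))) =
          Ω (Coalgebra.comul (b ⊗ₜ p)) (Coalgebra.comul (b' ⊗ₜ p')) := (hΩ _ _).symm
      refine e.trans ?_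
      rw [hΔ, hΔ, h, Coalgebra.lTensor_counit_comul, Coalgebra.lTensor_counit_comul,
        TensorProduct.rid_tmul, TensorProduct.rid_tmul, one_smul, one_smul, ← hΔ, hQ]
      apply LinearMap.ext
      intro v
      have := hitAntipode_conv_eval b p' (HopfAlgebra.antipode k p * v)
      rw [Module.End.mul_apply, Module.End.mul_apply, Module.End.mul_apply, hitAntipode_tmul,
        hitAntipode_tmul, LinearMap.mul_apply']
      exact congrArg (hit b') this

end SelfDual

/-! ### Operators on tensor products with a comodule -/

namespace FDComod

section CoactOp

variable {k : Type u} {K : Type v} [Field k] [Ring K] [HopfAlgebra k K]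
  {W : Type w} [AddCommGroup W] [Module k W]

/-- The operator `x ⊗ v ↦ x₀ ⊗ T(x₁) v` on `X ⊗ W`, for a linear map `T : K → End(W)`. -/
def coactOp (T : K →ₗ[k] Module.End k W) (X : FDComod k K inferInstance) :
    X ⊗[k] W →ₗ[k] X ⊗[k] W :=
  (TensorProduct.lift T).lTensor X ∘ₗ (TensorProduct.assoc k X K W).toLinearMap ∘ₗ
    X.coact.rTensor W

theorem lTensor_lift_assoc (T : K →ₗ[k] Module.End k W) {M : Type*} [AddCommGroup M] [Module k M]
    (z : M ⊗[k] K) (v : W) : (TensorProduct.lift T).lTensor M (TensorProduct.assoc k M K W (z ⊗ₜ v)) =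
      (T.flip v).lTensor M z := by
  induction z with
  | zero => simp
  | add x y hx hy => simp only [add_tmul, map_add, hx, hy]
  | tmul x y => simp

theorem coactOp_tmul (T : K →ₗ[k] Module.End k W) (X : FDComod k K inferInstance) (x : X) (v : W) :
    coactOp T X (x ⊗ₜ v) = (T.flip v).lTensor X (X.coact x) :=
  lTensor_lift_assoc T _ _

theorem coassoc_apply' (X : FDComod k K inferInstance) (x : X) :
    TensorProduct.assoc k X K K (X.coact.rTensor K (X.coact x)) =
      (Coalgebra.comul (R := k) (A := K)).lTensor X (X.coact x) :=
  X.coassoc_apply x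

theorem counit_apply' (X : FDComod k K inferInstance) (x : X) :
    (Coalgebra.counit (R := k) (A := K)).lTensor X (X.coact x) = x ⊗ₜ 1 :=
  X.counit_apply x

/-- By coassociativity both sides send x ⊗ v to x₀ ⊗ T(x₁) T'(x₂) v: composition of operators is
convolution of T and T'. -/
theorem coactOp_comp (T T' : K →ₗ[k] Module.End k W) (X : FDComod k K inferInstance) :
    coactOp T X ∘ₗ coactOp T' X =
      coactOp (LinearMap.mul' k _ ∘ₗ TensorProduct.map T T' ∘ₗ Coalgebra.comul) X := by
  apply TensorProduct.ext'
  intro x v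
  have h : ∀ z : X ⊗[k] K, coactOp T X ((T'.flip v).lTensor X z) =
      ((LinearMap.mul' k _ ∘ₗ TensorProduct.map T T').flip v).lTensor X
        (TensorProduct.assoc k X K K (X.coact.rTensor K z)) := by
    intro z
    induction z with
    | zero => simp
    | add x y hx hy => simp only [map_add, hx, hy]
    | tmul x a =>
      rw [LinearMap.lTensor_tmul, coactOp_tmul, LinearMap.rTensor_tmul]
      generalize X.coact x = t
      induction t with
      | zero => simp
      | add x y hx hy => simp only [map_add, add_tmul, hx, hy]
      | tmul x b => simp
  rw [LinearMap.comp_apply, coactOp_tmul, h, coassoc_apply', coactOp_tmul, ← LinearMap.comp_apply,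
    ← LinearMap.lTensor_comp]
  rfl

theorem coactOp_counit (X : FDComod k K inferInstance) :
    coactOp (Algebra.linearMap k (Module.End k W) ∘ₗ Coalgebra.counit) X = LinearMap.id := by
  apply TensorProduct.ext'
  intro x v
  have h : (Algebra.linearMap k (Module.End k W) ∘ₗ Coalgebra.counit (A := K)).flip v =
      LinearMap.toSpanSingleton k W v ∘ₗ Coalgebra.counit := by
    ext a
    simp
  rw [coactOp_tmul, h, LinearMap.lTensor_comp, LinearMap.comp_apply, counit_apply']
  simp

theorem coactOp_naturality (T : K →ₗ[k] Module.End k W) {X Y : FDComod k K inferInstance}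
    (f : X ⟶ Y) : f.lin.rTensor W ∘ₗ coactOp T X = coactOp T Y ∘ₗ f.lin.rTensor W := by
  apply TensorProduct.ext'
  intro x v
  rw [LinearMap.comp_apply, LinearMap.comp_apply, LinearMap.rTensor_tmul, coactOp_tmul,
    coactOp_tmul]
  have h : Y.coact (f.lin x) = f.lin.rTensor K (X.coact x) := LinearMap.congr_fun f.comm x
  rw [h]
  change (f.lin.rTensor W ∘ₗ (T.flip v).lTensor X) _ = ((T.flip v).lTensor Y ∘ₗ f.lin.rTensor K) _
  rw [LinearMap.rTensor_comp_lTensor, LinearMap.lTensor_comp_rTensor]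

theorem coactOp_unit (T : K →ₗ[k] Module.End k W) (hT : T 1 = 1) :
    coactOp T (unit k K) = LinearMap.id := by
  apply TensorProduct.ext'
  intro x v
  rw [coactOp_tmul]
  simp [hT]

theorem act₂_tmul [FiniteDimensional k K] (J : DualHopf k K ⊗[k] DualHopf k K)
    (X Y : FDComod k K inferInstance) (x : X) (y : Y) :
    act₂ X Y J (x ⊗ₜ y) = TensorProduct.rid k (X ⊗[k] Y)
      ((DualHopf.pair k K J).lTensor (X ⊗[k] Y) (TensorProduct.tensorTensorTensorComm k X K Y K
        (X.coact x ⊗ₜ Y.coact y))) := by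
  induction J with
  | zero => simp
  | add J J' h h' => simp only [map_add, LinearMap.add_apply, LinearMap.lTensor_add, h, h']
  | tmul ξ η =>
    change act X ξ x ⊗ₜ act Y η y = _
    rw [act_apply, act_apply]
    generalize X.coact x = z
    generalize Y.coact y = w
    induction z with
    | zero => simp
    | add z₁ z₂ h₁ h₂ => simp only [map_add, add_tmul, h₁, h₂]
    | tmul x a =>
    induction w with
    | zero => simp
    | add z₁ z₂ h₁ h₂ => simp only [map_add, tmul_add, h₁, h₂]
    | tmul y b =>
      simp only [LinearMap.lTensor_tmul, TensorProduct.rid_tmul,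
        TensorProduct.tensorTensorTensorComm_tmul, DualHopf.pair_tmul,
        TensorProduct.smul_tmul_smul]

/-- If `∑ T(a₁ b₁) J(a₂, b₂) = T(b) T(a)`, then the operators `coactOp T` are multiplicative up to
the action of `J`. -/
theorem coactOp_tensorHopf (T : K →ₗ[k] Module.End k W)
    [FiniteDimensional k K] (J : DualHopf k K ⊗[k] DualHopf k K)
    (hJ : ∀ a b : K, TensorProduct.rid k _ (TensorProduct.map (T ∘ₗ LinearMap.mul' k K)
      (DualHopf.pair k K J) (Coalgebra.comul (R := k) (a ⊗ₜ[k] b))) = T b * T a)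
    (X Y : FDComod k K inferInstance) :
    (TensorProduct.assoc k X Y W).toLinearMap ∘ₗ coactOp T (tensorHopf X Y) ∘ₗ
        (act₂ X Y J).rTensor W =
      (coactOp T Y).lTensor X ∘ₗ (TensorProduct.leftComm k Y X W).toLinearMap ∘ₗ
        (coactOp T X).lTensor Y ∘ₗ (TensorProduct.leftComm k X Y W).toLinearMap ∘ₗ
          (TensorProduct.assoc k X Y W).toLinearMap := by
  apply TensorProduct.ext_threefold
  intro x y v
  let E := Module.End k W
  -- Ψ collects the coefficients after each of x and y has been coacted on twice. The hypothesis
  -- `hJ` is its value on Δ(a) ⊗ Δ(b).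
  obtain ⟨Ψ, hΨ, hΨΔ⟩ : ∃ Ψ : (K ⊗[k] K) ⊗[k] (K ⊗[k] K) →ₗ[k] W,
      (∀ a a' b b', Ψ ((a ⊗ₜ a') ⊗ₜ (b ⊗ₜ b')) =
        DualHopf.pair k K J (a' ⊗ₜ b') • T (a * b) v) ∧
      ∀ a b : K, Ψ (Coalgebra.comul (R := k) a ⊗ₜ Coalgebra.comul (R := k) b) = T b (T a v) := by
    refine ⟨LinearMap.applyₗ v ∘ₗ (TensorProduct.rid k E).toLinearMap ∘ₗ
      TensorProduct.map (T ∘ₗ LinearMap.mul' k K) (DualHopf.pair k K J) ∘ₗ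
        (TensorProduct.tensorTensorTensorComm k K K K K).toLinearMap, ?_, ?_⟩
    · intro a a' b b'
      simp
    · intro a b
      exact LinearMap.congr_fun (hJ a b) v
  have h1 : ∀ (z : X ⊗[k] K) (w : Y ⊗[k] K), TensorProduct.assoc k X Y W
      (coactOp T (tensorHopf X Y) ((TensorProduct.rid k (X ⊗[k] Y)
        ((DualHopf.pair k K J).lTensor (X ⊗[k] Y)
          (TensorProduct.tensorTensorTensorComm k X K Y K (z ⊗ₜ w)))) ⊗ₜ v)) =
      TensorProduct.assoc k X Y W (Ψ.lTensor (X ⊗[k] Y)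
        (TensorProduct.tensorTensorTensorComm k X (K ⊗[k] K) Y (K ⊗[k] K)
          (TensorProduct.assoc k X K K (X.coact.rTensor K z) ⊗ₜ
            TensorProduct.assoc k Y K K (Y.coact.rTensor K w)))) := by
    intro z w
    congr 1
    rw [coactOp_tmul]
    change (T.flip v).lTensor (X ⊗[k] Y) (tensorCoact (LinearMap.mul' k K) X Y _) = _
    induction z with
    | zero => simp
    | add z₁ z₂ h₁ h₂ => simp only [map_add, add_tmul, h₁, h₂]
    | tmul x a' =>
    induction w with
    | zero => simp
    | add z₁ z₂ h₁ h₂ => simp only [map_add, tmul_add, h₁, h₂]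
    | tmul y b' =>
      simp only [TensorProduct.tensorTensorTensorComm_tmul, LinearMap.lTensor_tmul,
        TensorProduct.rid_tmul, map_smul, tensorCoact, LinearMap.comp_apply,
        TensorProduct.map_tmul, LinearMap.rTensor_tmul, LinearEquiv.coe_coe]
      generalize X.coact x = p
      generalize Y.coact y = q
      induction p with
      | zero => simp
      | add z₁ z₂ h₁ h₂ => simp only [map_add, add_tmul, smul_add, h₁, h₂]
      | tmul x a =>
      induction q with
      | zero => simp
      | add z₁ z₂ h₁ h₂ => simp only [map_add, add_tmul, tmul_add, smul_add, h₁, h₂]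
      | tmul y b => simp [hΨ]
  have h2 : ∀ (z : X ⊗[k] K) (w : Y ⊗[k] K), TensorProduct.assoc k X Y W (Ψ.lTensor (X ⊗[k] Y)
        (TensorProduct.tensorTensorTensorComm k X (K ⊗[k] K) Y (K ⊗[k] K)
          ((Coalgebra.comul (R := k) (A := K)).lTensor X z ⊗ₜ
            (Coalgebra.comul (R := k) (A := K)).lTensor Y w))) =
      ((TensorProduct.lift T).lTensor Y ∘ₗ
        (TensorProduct.assoc k Y K W).toLinearMap).lTensor X
          (TensorProduct.leftComm k (Y ⊗[k] K) X W (w ⊗ₜ ((T.flip v).lTensor X z))) := by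
    intro z w
    induction z with
    | zero => simp
    | add z₁ z₂ h₁ h₂ => simp only [map_add, add_tmul, tmul_add, h₁, h₂]
    | tmul x a =>
    induction w with
    | zero => simp
    | add z₁ z₂ h₁ h₂ => simp only [map_add, add_tmul, tmul_add, h₁, h₂]
    | tmul y b => simp [hΨΔ]
  have h3 : ∀ u : X ⊗[k] W, (coactOp T Y).lTensor X (TensorProduct.leftComm k Y X W (y ⊗ₜ u)) =
      ((TensorProduct.lift T).lTensor Y ∘ₗ
        (TensorProduct.assoc k Y K W).toLinearMap).lTensor X
          (TensorProduct.leftComm k (Y ⊗[k] K) X W (Y.coact y ⊗ₜ u)) := by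
    intro u
    induction u with
    | zero => simp
    | add z₁ z₂ h₁ h₂ => simp only [map_add, tmul_add, h₁, h₂]
    | tmul x w => simp [coactOp]
  simp only [LinearMap.comp_apply, LinearEquiv.coe_coe, LinearMap.rTensor_tmul,
    TensorProduct.assoc_tmul, TensorProduct.leftComm_tmul, LinearMap.lTensor_tmul]
  rw [act₂_tmul, h1, coassoc_apply', coassoc_apply', h2, h3, coactOp_tmul]

end CoactOp

end FDComod

/-! ### The operators s_X as comodule isomorphisms -/

section Intertwining

open DualHopf

variable {k : Type u} {B : Type u} [Field k] [CommRing B] [HopfAlgebra k B]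
  [FiniteDimensional k B]

/-- The tensor coaction sends x₀ ⊗ T(x₁) v to x₀ ⊗ (1 ⊗ x₁) ρ(T(x₂) v), by coassociativity of X. The
intertwining identity rewrites this as x₀ ⊗ T(x₁) v₀ ⊗ v₁. -/
theorem Intertwines.coactOp_comm {ρ : DualHopf k B →ₗ[k] DualHopf k B ⊗[k] DoubleCoord k B}
    (h : Intertwines ρ) (X : FDComod k (DoubleCoord k B) inferInstance) :
    ((LinearMap.mul' k (DoubleCoord k B)).lTensor (X ⊗[k] DualHopf k B) ∘ₗ
      (TensorProduct.tensorTensorTensorComm k X (DoubleCoord k B) (DualHopf k B)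
        (DoubleCoord k B)).toLinearMap ∘ₗ TensorProduct.map X.coact ρ) ∘ₗ
          FDComod.coactOp hitAntipode X =
    (FDComod.coactOp hitAntipode X).rTensor (DoubleCoord k B) ∘ₗ
      (TensorProduct.assoc k X (DualHopf k B) (DoubleCoord k B)).symm.toLinearMap ∘ₗ
        ρ.lTensor X := by
  apply TensorProduct.ext'
  intro x v
  let Ξ : DoubleCoord k B ⊗[k] DoubleCoord k B →ₗ[k] DualHopf k B ⊗[k] DoubleCoord k B :=
    LinearMap.mul' k _ ∘ₗ TensorProduct.map
      (Algebra.TensorProduct.includeRight :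
        DoubleCoord k B →ₐ[k] DualHopf k B ⊗[k] DoubleCoord k B).toLinearMap
      (ρ ∘ₗ hitAntipode.flip v)
  have h1 : ∀ z : X ⊗[k] DoubleCoord k B,
      ((LinearMap.mul' k (DoubleCoord k B)).lTensor (X ⊗[k] DualHopf k B)
        (TensorProduct.tensorTensorTensorComm k X (DoubleCoord k B) (DualHopf k B)
          (DoubleCoord k B) (TensorProduct.map X.coact ρ ((hitAntipode.flip v).lTensor X z)))) =
      (TensorProduct.assoc k X (DualHopf k B) (DoubleCoord k B)).symm
        (Ξ.lTensor X (TensorProduct.assoc k _ _ _ (X.coact.rTensor (DoubleCoord k B) z))) := by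
    intro z
    induction z with
    | zero => simp
    | add x y hx hy => simp only [map_add, hx, hy]
    | tmul x a =>
      simp only [LinearMap.lTensor_tmul, TensorProduct.map_tmul, LinearMap.rTensor_tmul]
      generalize X.coact x = t
      induction t with
      | zero => simp
      | add x y hx hy => simp only [map_add, add_tmul, hx, hy]
      | tmul x b =>
        simp only [TensorProduct.assoc_tmul, LinearMap.lTensor_tmul, Ξ, LinearMap.comp_apply,
          TensorProduct.map_tmul, LinearMap.mul'_apply]
        generalize ρ (hitAntipode.flip v a) = w
        induction w with
        | zero => simp
        | add x y hx hy => simp only [map_add, tmul_add, mul_add, hx, hy]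
        | tmul p c => simp
  have h2 : ∀ w : DualHopf k B ⊗[k] DoubleCoord k B,
      (FDComod.coactOp hitAntipode X).rTensor (DoubleCoord k B)
        ((TensorProduct.assoc k X (DualHopf k B) (DoubleCoord k B)).symm (x ⊗ₜ w)) =
      (TensorProduct.assoc k X (DualHopf k B) (DoubleCoord k B)).symm
        (((LinearMap.rTensorHom (DoubleCoord k B) ∘ₗ hitAntipode).flip w).lTensor X
          (X.coact x)) := by
    intro w
    induction w with
    | zero => simp
    | add x y hx hy => simp only [map_add, tmul_add, LinearMap.lTensor_add, LinearMap.add_apply,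
        hx, hy]
    | tmul p c =>
      rw [TensorProduct.assoc_symm_tmul, LinearMap.rTensor_tmul, FDComod.coactOp_tmul]
      generalize X.coact x = t
      induction t with
      | zero => simp
      | add x y hx hy => simp only [map_add, add_tmul, hx, hy]
      | tmul x b => simp
  have h3 : (LinearMap.rTensorHom (DoubleCoord k B) ∘ₗ hitAntipode).flip (ρ v) =
      Ξ ∘ₗ Coalgebra.comul := LinearMap.ext fun a => h a v
  simp only [LinearMap.comp_apply, LinearEquiv.coe_coe, FDComod.coactOp_tmul,
    LinearMap.lTensor_tmul]
  rw [h1, FDComod.coassoc_apply', h2, h3]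
  exact congrArg _ (LinearMap.congr_fun (LinearMap.lTensor_comp X Ξ Coalgebra.comul) _).symm

/-- A one-sided convolution inverse of T gives a right inverse of the operator, which suffices
because X ⊗ V is finite dimensional. -/
theorem coactOp_hitAntipode_bijective (X : FDComod k (DoubleCoord k B) inferInstance) :
    Function.Bijective (FDComod.coactOp (W := DualHopf k B) hitAntipode X) := by
  obtain ⟨T', hT'⟩ := exists_convInverse_hitAntipode (k := k) (B := B)
  have h : FDComod.coactOp hitAntipode X ∘ₗ FDComod.coactOp T' X = LinearMap.id := by
    rw [FDComod.coactOp_comp, ← FDComod.coactOp_counit]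
    congr 1
    exact LinearMap.ext hT'
  have hs : Function.Surjective (FDComod.coactOp (W := DualHopf k B) hitAntipode X) :=
    fun z => ⟨_, LinearMap.congr_fun h z⟩
  exact ⟨LinearMap.injective_iff_surjective.2 hs, hs⟩

end Intertwining

/-! ### Passage to cohomologous twists -/

/-- Both twists are normalized, so ε ⊗ id turns the relation between them into 1 = x · ε(x⁻¹) x⁻¹.
-/
theorem counit_of_cohomologous {k : Type u} {K : Type v} [Field k] [Ring K] [HopfAlgebra k K]
    {ψ ψ' : K ⊗[k] K} (hψ : IsTwist k K ψ) (hψ' : IsTwist k K ψ') (x : Kˣ)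
    (h : ψ' = Coalgebra.comul (R := k) (x : K) * ψ * ((↑x⁻¹ : K) ⊗ₜ[k] (↑x⁻¹ : K))) :
    Coalgebra.counit (R := k) (↑x⁻¹ : K) = 1 := by
  have h1 := hψ'.counit_left
  have h2 : Algebra.TensorProduct.lid k K (Algebra.TensorProduct.map (Bialgebra.counitAlgHom k K)
      (AlgHom.id k K) (Coalgebra.comul (x : K))) = x := by
    refine (congrArg (TensorProduct.lid k K) (Coalgebra.rTensor_counit_comul (x : K))).trans ?_
    simp
  rw [h, map_mul, map_mul, map_mul, map_mul, hψ.counit_left, mul_one, h2] at h1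
  have h3 := congrArg (Coalgebra.counit (R := k)) h1
  rw [Bialgebra.counit_one] at h3
  simp only [Algebra.TensorProduct.map_tmul, Bialgebra.counitAlgHom_apply, AlgHom.id_apply,
    Algebra.TensorProduct.lid_tmul, mul_smul_comm, Units.mul_inv, map_smul, Bialgebra.counit_one,
    smul_eq_mul, mul_one] at h3
  exact h3

/-- In Δ(a x⁻¹) ψ' the factors Δ(x⁻¹) and Δ(x) cancel. Right multiplication by x⁻¹ is therefore a
coalgebra map from K_ψ to K_ψ'. -/
theorem comul_mulRight_of_cohomologous {k : Type u} {K : Type v} [Field k] [Ring K]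
    [HopfAlgebra k K] {ψ ψ' : K ⊗[k] K} (x : Kˣ)
    (h : ψ' = Coalgebra.comul (R := k) (x : K) * ψ * ((↑x⁻¹ : K) ⊗ₜ[k] (↑x⁻¹ : K))) :
    Twist.twistedComul ψ' ∘ₗ LinearMap.mulRight k (↑x⁻¹ : K) =
      TensorProduct.map (LinearMap.mulRight k (↑x⁻¹ : K)) (LinearMap.mulRight k (↑x⁻¹ : K)) ∘ₗ
        Twist.twistedComul ψ := by
  have h1 : ∀ z : K ⊗[k] K, TensorProduct.map (LinearMap.mulRight k (↑x⁻¹ : K))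
      (LinearMap.mulRight k (↑x⁻¹ : K)) z = z * ((↑x⁻¹ : K) ⊗ₜ[k] (↑x⁻¹ : K)) := by
    intro z
    induction z with
    | zero => simp
    | add z₁ z₂ h₁ h₂ => simp only [map_add, add_mul, h₁, h₂]
    | tmul a b => simp
  ext a
  rw [LinearMap.comp_apply, LinearMap.comp_apply, h1, Twist.twistedComul_apply,
    Twist.twistedComul_apply, LinearMap.mulRight_apply, h, ← mul_assoc, ← mul_assoc,
    ← Bialgebra.comul_mul, mul_assoc a, Units.inv_mul, mul_one]

section Main

open DualHopf

variable {k : Type u} {B : Type u} [Field k] [CommRing B] [HopfAlgebra k B]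
  [FiniteDimensional k B] [Coalgebra.IsCocomm k B]

/-- The comodule `heisenbergComod` transported to a twisted coalgebra given by a cohomologous
twist. -/
@[reducible]
def heisenbergComodOf {ψ : DoubleCoord k B ⊗[k] DoubleCoord k B}
    (hψ : IsTwist k (DoubleCoord k B) ψ) (x : (DoubleCoord k B)ˣ)
    (h : ψ = Coalgebra.comul (R := k) (x : DoubleCoord k B) * pairingCocycle k B *
      ((↑x⁻¹ : DoubleCoord k B) ⊗ₜ[k] (↑x⁻¹ : DoubleCoord k B))) :
    FDComod k (DoubleCoord k B) (Twist.twistedCoalgebra hψ) :=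
  FDComod.push (cs := Twist.twistedCoalgebra (isTwist_pairingCocycle (k := k) (B := B)))
    (ds := Twist.twistedCoalgebra hψ) (LinearMap.mulRight k (↑x⁻¹ : DoubleCoord k B))
    (comul_mulRight_of_cohomologous x h)
    (by
      refine LinearMap.ext fun a => (Bialgebra.counit_mul (R := k) a _).trans ?_
      rw [counit_of_cohomologous isTwist_pairingCocycle hψ x h, mul_one]
      rfl)
    (heisenbergComod k B)

variable {ψ : DoubleCoord k B ⊗[k] DoubleCoord k B} (hψ : IsTwist k (DoubleCoord k B) ψ)

theorem heisenbergComodOf_dualAct_bijective (x : (DoubleCoord k B)ˣ)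
    (h : ψ = Coalgebra.comul (R := k) (x : DoubleCoord k B) * pairingCocycle k B *
      ((↑x⁻¹ : DoubleCoord k B) ⊗ₜ[k] (↑x⁻¹ : DoubleCoord k B))) :
    Function.Bijective (heisenbergComodOf hψ x h).dualAct :=
  FDComod.push_dualAct_bijective _ _ _ _ (Units.mulRight_bijective x⁻¹)
    heisenbergComod_dualAct_bijective

theorem isNondegenerate_of_cohomologous
    (h : Cohomologous k (DoubleCoord k B) (pairingCocycle k B) ψ) : IsNondegenerate hψ := by
  obtain ⟨x, hx⟩ := h
  have : Nontrivial (heisenbergComodOf hψ x hx) := inferInstanceAs (Nontrivial (DualHopf k B))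
  exact isNondegenerate_of_bijective hψ _ (heisenbergComodOf_dualAct_bijective hψ x hx)

/-- The transported coaction is ρ followed by right multiplication of coefficients by x⁻¹, so
`Intertwines.mulRight` applies. -/
theorem coactOp_comm_heisenbergComodOf (x : (DoubleCoord k B)ˣ)
    (h : ψ = Coalgebra.comul (R := k) (x : DoubleCoord k B) * pairingCocycle k B *
      ((↑x⁻¹ : DoubleCoord k B) ⊗ₜ[k] (↑x⁻¹ : DoubleCoord k B)))
    (X : FDComod k (DoubleCoord k B) inferInstance) :
    FDComod.tensorCoact (LinearMap.mul' k (DoubleCoord k B)) X (heisenbergComodOf hψ x h) ∘ₗ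
        FDComod.coactOp (W := DualHopf k B) hitAntipode X =
      (FDComod.coactOp (W := DualHopf k B) hitAntipode X).rTensor (DoubleCoord k B) ∘ₗ
        FDComod.freeCoact X (heisenbergComodOf hψ x h) := by
  have key := (intertwines_heisenbergCoact.mulRight (↑x⁻¹ : DoubleCoord k B)).coactOp_comm X
  unfold FDComod.tensorCoact FDComod.freeCoact
  exact key

/-- The isomorphism of comodules `X₀ ⊗ V ≅ X ⊗ V` given by `x ⊗ v ↦ x₀ ⊗ T(x₁) v`. -/
def heisenbergIso (x : (DoubleCoord k B)ˣ)
    (h : ψ = Coalgebra.comul (R := k) (x : DoubleCoord k B) * pairingCocycle k B *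
      ((↑x⁻¹ : DoubleCoord k B) ⊗ₜ[k] (↑x⁻¹ : DoubleCoord k B)))
    (X : FDComod k (DoubleCoord k B) inferInstance) :
    FDComod.free X (heisenbergComodOf hψ x h) ≅
      FDComod.tensorTwisted hψ X (heisenbergComodOf hψ x h) :=
  FDComod.isoOfBijective ⟨FDComod.coactOp (W := DualHopf k B) hitAntipode X,
    coactOp_comm_heisenbergComodOf hψ x h X⟩ (coactOp_hitAntipode_bijective X)

/-- The element x enters only through the coaction of V. The maps s_X and their relation to J are
the same for every cocycle in the class. -/
theorem correspondsTo_dualTwist (h : Cohomologous k (DoubleCoord k B) (pairingCocycle k B) ψ) :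
    CorrespondsTo hψ (dualTwist k B) := by
  obtain ⟨x, hx⟩ := h
  have : Nontrivial (heisenbergComodOf hψ x hx) := inferInstanceAs (Nontrivial (DualHopf k B))
  refine ⟨heisenbergComodOf hψ x hx,
    FDComod.freeFunctor_isEquivalence (heisenbergComodOf_dualAct_bijective hψ x hx),
    heisenbergIso hψ x hx, ?_, ?_, ?_⟩
  · intro X Y f
    exact FDComod.coactOp_naturality (W := DualHopf k B) hitAntipode f
  · exact FDComod.coactOp_unit (W := DualHopf k B) hitAntipode hitAntipode_one
  · intro X Y
    exact FDComod.coactOp_tensorHopf (W := DualHopf k B) hitAntipode (dualTwist k B) hitAntipode_mul_conv_dualTwist X Y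

end Main

end

theorem proposition6p8 {k : Type u} [Field k] [IsAlgClosed k]
    {B : Type u} [CommRing B] [HopfAlgebra k B] [FiniteDimensional k B] [Coalgebra.IsCocomm k B] :
    (∀ (R : Type w) [CommRing R] [Algebra k R] (a₁ a₂ : B →ₐ[k] R) (f₁ f₂ : DualHopf k B →ₐ[k] R),
      Algebra.TensorProduct.productMap (doublePoint k B a₁ f₁) (doublePoint k B a₂ f₂)
        (pairingCocycle k B) = cartierPairing k B f₁ a₂) ∧
    IsTwist k (DoubleCoord k B) (pairingCocycle k B) ∧
    ∃ (J : DualHopf k (DoubleCoord k B) ⊗[k] DualHopf k (DoubleCoord k B))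
      (hJ : IsTwist k (DualHopf k (DoubleCoord k B)) J),
      IsNondegenerate hJ ∧
      ∀ (ψ : DoubleCoord k B ⊗[k] DoubleCoord k B) (hψ : IsTwist k (DoubleCoord k B) ψ),
        Cohomologous k (DoubleCoord k B) (pairingCocycle k B) ψ →
          IsNondegenerate hψ ∧ CorrespondsTo hψ J :=
  ⟨fun _ _ _ => productMap_pairingCocycle, isTwist_pairingCocycle, dualTwist k B,
    isTwist_dualTwist, isNondegenerate_dualTwist, fun _ hψ h =>
      ⟨isNondegenerate_of_cohomologous hψ h, correspondsTo_dualTwist hψ h⟩⟩
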